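/- **Setting.** Let $\Theta\subseteq\mathbb{R}^p$ be a measurable parameter space, $\pi(\cdot)$ a prior probability density on $\Theta$, and, for each $n$ and each dataset $Y=(Y_1,\dots,Y_n)\in\mathbb{R}^{n\times d}$, let $\theta\mapsto\pi(Y\mid\theta)\ge 0$ be a measurable likelihood on $\Theta$. Let $\mathbb{P}_n^*$ be a probability measure on $\mathbb{R}^{n\times d}$ (the true data-generating distribution; the model need not be well specified). Put $\pi^*(\theta\mid Y)=\pi(\theta)\pi(Y\mid\theta)$, $\pi(Y)=\int_\Theta\pi^*(\theta\mid Y)\,d\theta$, $\pi(\theta\mid Y)=\pi^*(\theta\mid Y)/\pi(Y)$, $\ell_n(\theta)=\log\pi(Y\mid\theta)$, $\ell_n^\pi(\theta)=\log\pi^*(\theta\mid Y)$ (with $\log 0=-\infty$) and $H_n(\theta)=-\partial^2_\theta\,\ell^\pi_n(\theta)$. Let $\hat\theta_n\in\Theta$ be a posterior mode, i.e. a maximizer of $\pi^*(\cdot\mid Y)$ over $\Theta$ (assumed to exist with probability tending to $1$), and let $\hat L_n$ be the Cholesky factor (lower triangular, positive diagonal) of $H_n(\hat\theta_n)^{-1}=\hat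 L_n\hat L_n^{\top}$. A quadrature rule $(\mathcal{Q},\omega)$ is a finite set $\mathcal{Q}\subset\mathbb{R}^p$ with weights $\omega:\mathcal{Q}\to\mathbb{R}$. It is symmetric if $z\in\mathcal{Q}$ implies $-z\in\mathcal{Q}$ and $\omega(-z)=\omega(z)$. With $\phi$ the standard normal density on $\mathbb{R}^p$, it satisfies $\mathbf{P}(k,p)$ if $\int_{\mathbb{R}^p}\phi(z)f(z)\,dz=\sum_{z\in\mathcal{Q}}\phi(z)f(z)\omega(z)$ for every polynomial $f$ in $p$ variables of total degree at most $2k-1$. The adapted approximations are $$\tilde\pi(Y)=|\hat L_n|\sum_{z\in\mathcal{Q}}\pi^*(\hat L_nz+\hat\theta_n\mid Y)\,\omega(z),\qquad \tilde\pi(\theta\mid Y)=\frac{\pi^*(\theta\mid Y)}{\tilde\pi(Y)},$$ where $|\cdot|$ of a matrix is its determinant. **Assumptions.** Let $m\ge 4$ be an integer such that, for every $n$ and $\mathbb{P}_n^*$-almost every $Y$, the likelihood $\pi(Y\mid\theta)$ is $m$-times differentiable in $\theta$ on the interior of $\Theta$. Suppose there are $\theta^*\in\Theta$ and $\delta>0$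 such that, writing $B=\{\theta:\|\theta-\theta^*\|_2<\delta\}$, we have $B\subseteq\Theta$ and: 1. there is $M>0$ such that, with $\mathbb{P}^*_n$-probability tending to $1$, $\ell_n^\pi$ is finite and $m$-times differentiable on $B$ and $|\partial^\alpha\ell_n^\pi(\theta)|<nM$ for all $\theta\in B$ and all multi-indices $0\le|\alpha|\le m$; 2. there are $0<\underline\eta\le\overline\eta<\infty$ such that, with $\mathbb{P}^*_n$-probability tending to $1$, all eigenvalues of $H_n(\theta)$ lie in $[n\underline\eta,n\overline\eta]$ for all $\theta\in B$; 3. there is $b>0$ such that, with $\mathbb{P}^*_n$-probability tending to $1$, $\sup_{\theta\in\Theta\setminus B}\ell_n(\theta)-\ell_n(\theta^*)\le -nb$; 4. for every $\beta>0$ and every $G(n)\to\infty$, $\lim_{n\to\infty}\mathbb{P}_n^*\big[\tfrac{\sqrt n}{G(n)}\|\hat\theta_n-\theta^*\|_2>\beta\big]=0$; 5. there are $0<c_1<c_2<\infty$ with $c_1\le\pi(\theta)\le c_2$ for all $\theta\in B$. **Conclusion.** Let $1\le k\le\lfloor m/2\rfloor$ and let $(\mathcal{Q},\omega)$ be a symmetric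 quadrature rule satisfying $\mathbf{P}(k,p)$. Then there is a constant $C>0$ such that $$\lim_{n\to\infty}\mathbb{P}_n^*\left(\sup_{\theta\in\Theta}\left|\frac{\pi(\theta\mid Y)}{\tilde\pi(\theta\mid Y)}-1\right|\le C\,n^{-\lfloor (k+2)/3\rfloor}\right)=1$$ and $$\lim_{n\to\infty}\mathbb{P}_n^*\left(\big\|\pi(\cdot\mid Y)-\tilde\pi(\cdot\mid Y)\big\|_{\mathrm{TV}}\le C\,n^{-\lfloor (k+2)/3\rfloor}\right)=1,$$ where the supremum is over those $\theta\in\Theta$ with $\pi^*(\theta\mid Y)\ne 0$ and $\|f-g\|_{\mathrm{TV}}=\sup_{K}\big|\int_{K\cap\Theta}(f-g)\,d\theta\big|$ over Borel sets $K\subseteq\mathbb{R}^p$. -/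

import Mathlib

open MeasureTheory Filter Topology
open scoped ENNReal

noncomputable section

namespace AdaptiveQuadrature

/-- Parameter vectors in `ℝ^p`, with the Euclidean norm. -/
abbrev Param (p : ℕ) : Type := EuclideanSpace ℝ (Fin p)

/-- Datasets `Y = (Y_1, …, Y_n)` of `n` observations in `ℝ^d`. -/
abbrev Dataset (d n : ℕ) : Type := Fin n → EuclideanSpace ℝ (Fin d)

/-! ### Derivatives -/

/-- The mixed partial derivative `∂_{i_1} ⋯ ∂_{i_j} f (x)`. -/
def mixedPartial {p j : ℕ} (f : Param p → ℝ) (i : Fin j → Fin p) (x : Param p) : ℝ :=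
  iteratedFDeriv ℝ j f x (fun l => EuclideanSpace.single (i l) (1 : ℝ))

/-- `f` is `m`-times (Fréchet) differentiable at every point of the open set `U`; the derivative of
order `m` need not be continuous. -/
def TimesDifferentiableOn {p : ℕ} (m : ℕ) (f : Param p → ℝ) (U : Set (Param p)) : Prop :=
  ∀ j < m, DifferentiableOn ℝ (iteratedFDeriv ℝ j f) U

/-! ### Cholesky factors -/

/-- `L` is lower triangular with positive diagonal and `L Lᵀ = A`. -/
def IsCholeskyFactor {p : ℕ} (L A : Matrix (Fin p) (Fin p) ℝ) : Prop :=
  (∀ i j, i < j → L i j = 0) ∧ (∀ i, 0 < L i i) ∧ L * L.transpose = A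

open Classical in
/-- The Cholesky factor of `A` (it exists and is unique for positive definite `A`; the value is `0`
if there is none). -/
def choleskyFactor {p : ℕ} (A : Matrix (Fin p) (Fin p) ℝ) : Matrix (Fin p) (Fin p) ℝ :=
  if h : ∃ L, IsCholeskyFactor L A then h.choose else 0

/-! ### Quadrature rules -/

/-- A quadrature rule in `ℝ^p`: finitely many points, and a weight function (of which only the
values at the points matter). -/
structure QuadRule (p : ℕ) where
  points : Finset (Param p)
  weight : Param p → ℝ

/-- The density of the standard normal distribution on `ℝ^p`. -/
def stdNormalDensity {p : ℕ} (z : Param p) : ℝ :=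
  (2 * Real.pi) ^ (-(p : ℝ) / 2) * Real.exp (-‖z‖ ^ 2 / 2)

/-- The rule integrates exactly the product of the standard normal density on `ℝ^p` and any
polynomial of total degree at most `2k - 1`. -/
def QuadRule.IsExact {p : ℕ} (R : QuadRule p) (k : ℕ) : Prop :=
  ∀ f : MvPolynomial (Fin p) ℝ, f.totalDegree < 2 * k →
    ∫ z : Param p, stdNormalDensity z * MvPolynomial.eval (fun i => z i) f =
      ∑ z ∈ R.points, stdNormalDensity z * MvPolynomial.eval (fun i => z i) f * R.weight z

/-- The rule is symmetric about the origin. -/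
def QuadRule.IsSymmetric {p : ℕ} (R : QuadRule p) : Prop :=
  ∀ z ∈ R.points, -z ∈ R.points ∧ R.weight z = R.weight (-z)

/-! ### Bayesian models -/

/-- A parameter space `Θ ⊆ ℝ^p`, a prior density on it, and for each sample size `n` a likelihood
`θ ↦ π(Y ∣ θ)` of every dataset `Y`. Prior and likelihood are only constrained on `Θ`. -/
structure BayesModel (p d : ℕ) where
  space : Set (Param p)
  measurableSet_space : MeasurableSet space
  prior : Param p → ℝ
  prior_nonneg : ∀ θ ∈ space, 0 ≤ prior θ
  integral_prior : ∫ θ in space, prior θ = 1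
  lik : (n : ℕ) → Dataset d n → Param p → ℝ
  lik_nonneg : ∀ n Y, ∀ θ ∈ space, 0 ≤ lik n Y θ
  aemeasurable_lik : ∀ n Y, AEMeasurable (lik n Y) (volume.restrict space)

namespace BayesModel

variable {p d : ℕ} (M : BayesModel p d)

/-- The unnormalized posterior `π*(θ ∣ Y) = π(θ) π(Y ∣ θ)`. -/
def unnormPost (n : ℕ) (Y : Dataset d n) (θ : Param p) : ℝ :=
  M.prior θ * M.lik n Y θ

/-- The normalizing constant (marginal likelihood) `π(Y) = ∫_Θ π*(θ ∣ Y) dθ`. -/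
def normConst (n : ℕ) (Y : Dataset d n) : ℝ :=
  ∫ θ in M.space, M.unnormPost n Y θ

/-- The posterior density `π(θ ∣ Y)`. -/
def post (n : ℕ) (Y : Dataset d n) (θ : Param p) : ℝ :=
  M.unnormPost n Y θ / M.normConst n Y

/-- The log-likelihood. -/
def logLik (n : ℕ) (Y : Dataset d n) (θ : Param p) : ℝ :=
  Real.log (M.lik n Y θ)

/-- The unnormalized log-posterior. -/
def logPost (n : ℕ) (Y : Dataset d n) (θ : Param p) : ℝ :=
  Real.log (M.unnormPost n Y θ)

/-- The negative Hessian `H_n(θ)` of the log-posterior. -/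
def negHessian (n : ℕ) (Y : Dataset d n) (θ : Param p) : Matrix (Fin p) (Fin p) ℝ :=
  Matrix.of fun i j => -mixedPartial (M.logPost n Y) ![i, j] θ

/-- `θ` maximizes the posterior density over `Θ`. -/
def IsPosteriorMode (n : ℕ) (Y : Dataset d n) (θ : Param p) : Prop :=
  θ ∈ M.space ∧ IsMaxOn (M.unnormPost n Y) M.space θ

/-- The adapted approximation to the normalizing constant given by the rule `R` and the mode `θhat`:
`|L| ∑_z π*(L z + θhat ∣ Y) ω(z)`, where `L` is the Cholesky factor of `H_n(θhat)⁻¹`. -/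
def adaptedConst (R : QuadRule p) (n : ℕ) (Y : Dataset d n) (θhat : Param p) : ℝ :=
  let L := choleskyFactor (M.negHessian n Y θhat)⁻¹
  L.det * ∑ z ∈ R.points,
    M.unnormPost n Y (WithLp.toLp 2 (L.mulVec (fun i => z i)) + θhat) * R.weight z

/-- The approximate posterior density, normalized by the adapted approximation. -/
def adaptedPost (R : QuadRule p) (n : ℕ) (Y : Dataset d n) (θhat : Param p) (θ : Param p) : ℝ :=
  M.unnormPost n Y θ / M.adaptedConst R n Y θhat

/-- The uniform relative error between two densities `f` and `g` proportional to the unnormalized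
posterior: the supremum of `|f(θ) / g(θ) - 1|` over all `θ ∈ Θ` at which the unnormalized posterior
does not vanish (elsewhere the ratio reads `0 / 0`). -/
def relError (n : ℕ) (Y : Dataset d n) (f g : Param p → ℝ) : ℝ≥0∞ :=
  ⨆ θ ∈ {θ | θ ∈ M.space ∧ M.unnormPost n Y θ ≠ 0}, ENNReal.ofReal |f θ / g θ - 1|

/-- The total variation distance between two densities on `Θ`: the supremum over Borel sets `K`
of `|∫_{K ∩ Θ} (f - g)|`. -/
def tvDist (f g : Param p → ℝ) : ℝ≥0∞ :=
  ⨆ K ∈ {K : Set (Param p) | MeasurableSet K},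
    ENNReal.ofReal |∫ θ in K ∩ M.space, (f θ - g θ)|

end BayesModel

/-! ### Data-generating distributions and regularity -/

/-- The event `E n` has probability tending to one. It is expressed by the (outer) probability of
its complement tending to zero, so that it means the right thing also for events that are not known
to be measurable. -/
def WithProbTendingToOne {d : ℕ} (P : (n : ℕ) → Measure (Dataset d n))
    (E : (n : ℕ) → Dataset d n → Prop) : Prop :=
  Tendsto (fun n => P n {Y | ¬ E n Y}) atTop (𝓝 0)

/-- The regularity assumptions on the model, the data-generating distributions `P n`, the posterior
mode `θhat` and the order of differentiability `m`, for a given centre `θstar` and radius `δ`.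
Here `Real.log` is only used at positive arguments: a vanishing likelihood has logarithm `-∞`. -/
structure RegularAt {p d : ℕ} (M : BayesModel p d) (P : (n : ℕ) → Measure (Dataset d n))
    (θhat : (n : ℕ) → Dataset d n → Param p) (m : ℕ) (θstar : Param p) (δ : ℝ) : Prop where
  /-- The ball on which prior and likelihood are controlled lies in the parameter space. -/
  ball_subset : Metric.ball θstar δ ⊆ M.space
  /-- On the ball the log-posterior is finite and `m`-times differentiable, and all its partial
  derivatives of order `0` to `m` are bounded by `n B`. -/
  derivatives : ∃ B : ℝ, 0 < B ∧ WithProbTendingToOne P fun n Y =>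
    (∀ θ ∈ Metric.ball θstar δ, 0 < M.unnormPost n Y θ) ∧
    TimesDifferentiableOn m (M.logPost n Y) (Metric.ball θstar δ) ∧
    ∀ j ≤ m, ∀ i : Fin j → Fin p, ∀ θ ∈ Metric.ball θstar δ,
      |mixedPartial (M.logPost n Y) i θ| < n * B
  /-- On the ball all eigenvalues of the negative Hessian lie between `n ηlo` and `n ηhi`. -/
  hessian : ∃ ηlo ηhi : ℝ, 0 < ηlo ∧ ηlo ≤ ηhi ∧ WithProbTendingToOne P fun n Y =>
    ∀ θ ∈ Metric.ball θstar δ, ∀ μ ∈ spectrum ℝ (M.negHessian n Y θ),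
      n * ηlo ≤ μ ∧ μ ≤ n * ηhi
  /-- Off the ball the log-likelihood is smaller than at the centre by at least `n b`. -/
  separation : ∃ b : ℝ, 0 < b ∧ WithProbTendingToOne P fun n Y =>
    ∀ θ ∈ M.space \ Metric.ball θstar δ, 0 < M.lik n Y θ →
      M.logLik n Y θ - M.logLik n Y θstar ≤ -(n * b)
  /-- The posterior mode is consistent at rate `√n`. -/
  consistency : ∀ β : ℝ, 0 < β → ∀ G : ℕ → ℝ, Tendsto G atTop atTop →
    Tendsto (fun n : ℕ => P n {Y | β < √(n : ℝ) / G n * ‖θhat n Y - θstar‖}) atTop (𝓝 0)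
  /-- On the ball the prior is bounded above and away from zero. -/
  prior_bounds : ∃ c₁ c₂ : ℝ, 0 < c₁ ∧ c₁ < c₂ ∧ ∀ θ ∈ Metric.ball θstar δ,
    c₁ ≤ M.prior θ ∧ M.prior θ ≤ c₂

/-- The regularity assumptions hold for some `θstar ∈ Θ` and some `δ > 0`. -/
def Regular {p d : ℕ} (M : BayesModel p d) (P : (n : ℕ) → Measure (Dataset d n))
    (θhat : (n : ℕ) → Dataset d n → Param p) (m : ℕ) : Prop :=
  ∃ θstar ∈ M.space, ∃ δ : ℝ, 0 < δ ∧ RegularAt M P θhat m θstar δ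

end AdaptiveQuadrature

end

/-! In adapted coordinates `θ = L z + θhat` the mode removes the linear term of the log-posterior
and the Cholesky factor makes its quadratic term exactly `-‖z‖² / 2`. Derivatives of order `j` have
size `n` while `L` shrinks lengths by `ε = n^(-1/2)`, so the remaining Taylor terms `T j`, `j ≥ 3`,
are homogeneous polynomials of degree `j` and size `ε^(j - 2)`. After division by `det L` and the
posterior value at the mode, the marginal likelihood over the ball is the Lebesgue integral of `F(z)
= exp(-‖z‖²/2 + T 3 + T 4 + ⋯)`, and the adapted approximation is the quadrature sum of the same
`F`.

Expanding the exponential, a product of `t` terms has degree `D` and size `ε^r` with `D = r + 2t`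
and `r ≥ t`; hence `D ≡ r` mod 2 and `D ≤ 3r`. With `s = ⌊(k+2)/3⌋`, an odd product has no
quadrature error by symmetry. An even one with `r < 2s` has `D ≤ 6s - 6 ≤ 2k - 2` and is integrated
exactly. All others are of size `ε^(2s) = n^(-s)`. This case distinction
(`QuadRule.abs_error_homogeneous_le`) is the source of the rate.

Truncation costs at most `ε^(2s)` times a polynomial times a Gaussian with constant `ηlo / ηhi`
(`exists_abs_rescaled_sub_le`), a bound that serves both the integral and the sum. Off the ball the
mass is at most of order `exp(-n b)`, which beats the polynomial size of `det L`. A uniform lower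
bound for the integral of `F` makes the error relative (`exists_abs_adaptedConst_sub_le`). The two
posterior densities differ only by their constants, so both conclusions follow. Probability enters
only through the event `RegularDataset`; on it everything is deterministic with uniform constants.
-/

noncomputable section

namespace AdaptiveQuadrature

/-! ### Taylor bounds -/

/-- One-sided Taylor bound on `[0, T]` for a chain of successive derivatives. -/
theorem le_taylor_of_hasDerivAt (N : ℕ) : ∀ (g : ℕ → ℝ → ℝ) (T K : ℝ),
    (∀ j < N, ∀ t ∈ Set.Icc 0 T, HasDerivAt (g j) (g (j + 1) t) t) →
    (∀ t ∈ Set.Icc 0 T, g N t ≤ K) → ∀ t ∈ Set.Icc 0 T,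
    g 0 t ≤ ∑ j ∈ Finset.range N, g j 0 * t ^ j / j.factorial + K * t ^ N / N.factorial := by
  induction N with
  | zero => intro g T K _ hK t ht; simpa using hK t ht
  | succ N ih =>
    intro g T K hg hK t ht
    have h1 := ih (fun j => g (j + 1)) T K (fun j hj t ht => hg (j + 1) (by omega) t ht) hK
    set q : ℝ → ℝ := fun t => ∑ j ∈ Finset.range (N + 1), g j 0 * t ^ j / j.factorial
      + K * t ^ (N + 1) / (N + 1).factorial with hq
    have hpow : ∀ (a : ℝ) (j : ℕ) (t : ℝ),
        HasDerivAt (fun t : ℝ => a * t ^ (j + 1) / (j + 1).factorial)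
          (a * t ^ j / j.factorial) t := by
      intro a j t
      have := ((hasDerivAt_pow (j + 1) t).const_mul a).div_const ((j + 1).factorial : ℝ)
      refine this.congr_deriv ?_
      rw [Nat.factorial_succ]
      have : (j.factorial : ℝ) ≠ 0 := by positivity
      push_cast
      field_simp
    have hqd : ∀ t, HasDerivAt q
        (∑ j ∈ Finset.range N, g (j + 1) 0 * t ^ j / j.factorial + K * t ^ N / N.factorial) t := by
      intro t
      have hq' : q = fun t => (∑ j ∈ Finset.range N, g (j + 1) 0 * t ^ (j + 1) / (j + 1).factorial
          + g 0 0) + K * t ^ (N + 1) / (N + 1).factorial := by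
        funext t
        simp [hq, Finset.sum_range_succ']
      rw [hq']
      refine HasDerivAt.add (HasDerivAt.add_const _ ?_) (hpow _ _ _)
      exact HasDerivAt.fun_sum fun j _ => hpow _ _ _
    -- Monotonicity replaces integration of the inductive bound, because the top derivative is not
    -- assumed continuous or integrable.
    have hmono : MonotoneOn (fun t => q t - g 0 t) (Set.Icc 0 T) := by
      refine monotoneOn_of_deriv_nonneg (convex_Icc 0 T) ?_ ?_ ?_
      · exact fun x hx => ((hqd x).sub (hg 0 (by omega) x hx)).continuousAt.continuousWithinAt
      · intro x hx
        rw [interior_Icc] at hx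
        exact ((hqd x).sub (hg 0 (by omega) x (Set.Ioo_subset_Icc_self hx))).differentiableAt
          |>.differentiableWithinAt
      · intro x hx
        rw [interior_Icc] at hx
        have hx' := Set.Ioo_subset_Icc_self hx
        have : deriv (fun t => q t - g 0 t) x = _ := ((hqd x).sub (hg 0 (by omega) x hx')).deriv
        rw [this]
        have := h1 x hx'
        simp only [zero_add] at *
        linarith
    have h0 : q 0 - g 0 0 = 0 := by
      simp [hq, Finset.sum_range_succ']
    have := hmono ⟨le_rfl, ht.1.trans ht.2⟩ ht ht.1
    simp only [h0] at this
    simp only [hq] at this ⊢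
    linarith

/-- One-sided multivariate Taylor bound along a segment in a convex open set. -/
theorem le_taylor_of_timesDifferentiableOn {p : ℕ} {N : ℕ} {f : Param p → ℝ} {U : Set (Param p)}
    (hU : IsOpen U) (hUc : Convex ℝ U) (hf : TimesDifferentiableOn N f U) {x v : Param p}
    (hx : x ∈ U) (hxv : x + v ∈ U) {K : ℝ}
    (hK : ∀ y ∈ U, iteratedFDeriv ℝ N f y (fun _ => v) ≤ K) :
    f (x + v) ≤ ∑ j ∈ Finset.range N, iteratedFDeriv ℝ j f x (fun _ => v) / j.factorial
      + K / N.factorial := by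
  have hseg : ∀ t ∈ Set.Icc (0 : ℝ) 1, x + t • v ∈ U := by
    intro t ht
    have := hUc hx hxv (sub_nonneg.2 ht.2) ht.1 (by ring)
    convert this using 1
    module
  have := le_taylor_of_hasDerivAt N
    (fun j t => iteratedFDeriv ℝ j f (x + t • v) (fun _ => v)) 1 K ?_
    (fun t ht => hK _ (hseg t ht)) 1 (by simp)
  · simpa using this
  · intro j hj t ht
    have hd : HasFDerivAt (iteratedFDeriv ℝ j f) (fderiv ℝ (iteratedFDeriv ℝ j f) (x + t • v))
        (x + t • v) :=
      ((hf j hj).differentiableAt (hU.mem_nhds (hseg t ht))).hasFDerivAt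
    have hline : HasDerivAt (fun t : ℝ => x + t • v) v t := by
      simpa using ((hasDerivAt_id t).smul_const v).const_add x
    have h1 := hd.comp_hasDerivAt t hline
    have h2 := ((ContinuousMultilinearMap.apply ℝ (fun _ : Fin j => Param p) ℝ
      (fun _ => v)).hasFDerivAt).comp_hasDerivAt t h1
    exact h2

theorem iteratedFDeriv_neg' {p : ℕ} (f : Param p → ℝ) (j : ℕ) (x v : Param p) :
    iteratedFDeriv ℝ j (-f) x (fun _ => v) = -iteratedFDeriv ℝ j f x (fun _ => v) := by
  rw [iteratedFDeriv_neg_apply]; rfl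

theorem TimesDifferentiableOn.neg {p N : ℕ} {f : Param p → ℝ} {U : Set (Param p)}
    (hf : TimesDifferentiableOn N f U) : TimesDifferentiableOn N (-f) U := by
  intro j hj
  have : iteratedFDeriv ℝ j (-f) = fun x => -iteratedFDeriv ℝ j f x := by
    funext x; exact iteratedFDeriv_neg_apply
  rw [this]
  exact (hf j hj).neg

/-- Multivariate Taylor theorem with bounded remainder. -/
theorem abs_sub_taylor_le {p : ℕ} {N : ℕ} {f : Param p → ℝ} {U : Set (Param p)}
    (hU : IsOpen U) (hUc : Convex ℝ U) (hf : TimesDifferentiableOn N f U) {x v : Param p}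
    (hx : x ∈ U) (hxv : x + v ∈ U) {K : ℝ}
    (hK : ∀ y ∈ U, |iteratedFDeriv ℝ N f y (fun _ => v)| ≤ K) :
    |f (x + v) - ∑ j ∈ Finset.range N, iteratedFDeriv ℝ j f x (fun _ => v) / j.factorial|
      ≤ K / N.factorial := by
  have h1 := le_taylor_of_timesDifferentiableOn hU hUc hf hx hxv
    (fun y hy => (abs_le.1 (hK y hy)).2)
  have h2 := le_taylor_of_timesDifferentiableOn hU hUc hf.neg hx hxv (K := K)
    (fun y hy => by rw [iteratedFDeriv_neg']; linarith [(abs_le.1 (hK y hy)).1])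
  simp only [iteratedFDeriv_neg', neg_div, Finset.sum_neg_distrib, Pi.neg_apply] at h2
  rw [abs_le]
  constructor <;> linarith

/-- Expansion of a diagonal value of the `j`-th derivative in mixed partial derivatives. -/
theorem iteratedFDeriv_diag_eq_sum {p j : ℕ} (f : Param p → ℝ) (x v : Param p) :
    iteratedFDeriv ℝ j f x (fun _ => v) =
      ∑ i : Fin j → Fin p, (∏ l, v (i l)) * mixedPartial f i x := by
  have hv : v = ∑ a, v a • EuclideanSpace.single a (1 : ℝ) := by
    ext b
    simp [Finset.sum_apply, Pi.single_apply]
  conv_lhs => rw [hv]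
  rw [ContinuousMultilinearMap.map_sum]
  refine Finset.sum_congr rfl fun i _ => ?_
  rw [ContinuousMultilinearMap.map_smul_univ]
  rfl

/-- The expansion has `p ^ j` index tuples, and each coordinate of `v` is at most its norm. -/
theorem abs_iteratedFDeriv_diag_le {p j : ℕ} {f : Param p → ℝ} {x : Param p} {K : ℝ}
    (hK : ∀ i : Fin j → Fin p, |mixedPartial f i x| ≤ K) (v : Param p) :
    |iteratedFDeriv ℝ j f x (fun _ => v)| ≤ (p : ℝ) ^ j * K * ‖v‖ ^ j := by
  rw [iteratedFDeriv_diag_eq_sum]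
  refine (Finset.abs_sum_le_sum_abs _ _).trans ?_
  have : ∀ i ∈ (Finset.univ : Finset (Fin j → Fin p)),
      |(∏ l, v (i l)) * mixedPartial f i x| ≤ ‖v‖ ^ j * K := by
    intro i _
    rw [abs_mul, Finset.abs_prod]
    refine mul_le_mul ?_ (hK i) (abs_nonneg _) (by positivity)
    calc ∏ l, |v (i l)| ≤ ∏ _l : Fin j, ‖v‖ :=
          Finset.prod_le_prod (fun _ _ => abs_nonneg _) (fun l _ => PiLp.norm_apply_le v (i l))
      _ = ‖v‖ ^ j := by simp
  refine (Finset.sum_le_sum this).trans (le_of_eq ?_)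
  simp
  ring

/-- Taylor remainder of the exponential, uniformly for arguments of either sign. -/
theorem abs_exp_sub_sum_le (n : ℕ) (x : ℝ) :
    |Real.exp x - ∑ t ∈ Finset.range n, x ^ t / t.factorial| ≤
      (n + 3) * |x| ^ n * max 1 (Real.exp x) := by
  have hmax : 1 ≤ max 1 (Real.exp x) := le_max_left _ _
  have hb : |Real.exp x - ∑ t ∈ Finset.range n, x ^ t / t.factorial| ≤
      |x| ^ n * Real.exp |x| := by
    have := Complex.norm_exp_sub_sum_le_norm_mul_exp (x : ℂ) n
    rw [Complex.norm_real, Real.norm_eq_abs] at this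
    refine le_trans (le_of_eq ?_) this
    rw [← Real.norm_eq_abs, ← Complex.norm_real]
    push_cast
    rfl
  -- The usual factor `exp |x|` would destroy Gaussian decay for very negative `x`. For `x ≥ -1` it
  -- costs only a factor 3, since `e < 3`; for `x < -1` the exponential and each of the `n` Taylor
  -- terms are already at most `|x| ^ n`.
  rcases le_or_gt (-1) x with hx | hx
  · refine hb.trans ?_
    have he : Real.exp |x| ≤ 3 * max 1 (Real.exp x) := by
      rcases le_or_gt 0 x with h | h
      · rw [abs_of_nonneg h]
        nlinarith [le_max_right 1 (Real.exp x)]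
      · rw [abs_of_neg h]
        have : Real.exp (-x) ≤ Real.exp 1 := Real.exp_le_exp.2 (by linarith)
        have := Real.exp_one_lt_d9
        nlinarith
    calc |x| ^ n * Real.exp |x| ≤ |x| ^ n * (3 * max 1 (Real.exp x)) := by gcongr
      _ ≤ _ := by
        have : 0 ≤ (n : ℝ) * (|x| ^ n * max 1 (Real.exp x)) := by positivity
        linarith
  · have hx1 : 1 ≤ |x| := by rw [abs_of_neg (by linarith)]; linarith
    have h1 : |Real.exp x| ≤ |x| ^ n := by
      rw [abs_of_pos (Real.exp_pos _)]
      exact (Real.exp_le_one_iff.2 (by linarith)).trans (one_le_pow₀ hx1)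
    have h2 : |∑ t ∈ Finset.range n, x ^ t / t.factorial| ≤ n * |x| ^ n := by
      refine (Finset.abs_sum_le_sum_abs _ _).trans ?_
      have : ∀ t ∈ Finset.range n, |x ^ t / t.factorial| ≤ |x| ^ n := by
        intro t ht
        rw [abs_div, abs_pow, abs_of_pos (by positivity : (0 : ℝ) < t.factorial)]
        have ht1 : (1 : ℝ) ≤ t.factorial := by exact_mod_cast t.factorial_pos
        refine (div_le_self (by positivity) ht1).trans ?_
        exact pow_le_pow_right₀ hx1 (Finset.mem_range.1 ht).le
      refine (Finset.sum_le_sum this).trans (by simp)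
    calc _ ≤ |x| ^ n + n * |x| ^ n := (abs_sub _ _).trans (add_le_add h1 h2)
      _ ≤ (n + 3) * |x| ^ n * 1 := by nlinarith [pow_nonneg (abs_nonneg x) n]
      _ ≤ _ := by gcongr

/-! ### Cholesky factors of positive definite matrices -/

open Matrix in
/-- Every positive definite real matrix has a Cholesky factor. -/
theorem exists_isCholeskyFactor {p : ℕ} {A : Matrix (Fin p) (Fin p) ℝ} (hA : A.PosDef) :
    ∃ L, IsCholeskyFactor L A := by
  set W := LDL.lowerInv hA with hW
  have hWtri : W.BlockTriangular OrderDual.toDual := fun i j hij => LDL.lowerInv_triangular hA hij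
  have hVtri : W⁻¹.BlockTriangular OrderDual.toDual :=
    blockTriangular_inv_of_blockTriangular hWtri
  have hdet : W⁻¹.det ≠ 0 := by
    have : IsUnit W⁻¹.det := by
      rw [isUnit_nonsing_inv_det_iff]
      exact isUnit_det_of_invertible W
    exact this.ne_zero
  have hVdiag : ∀ i, W⁻¹ i i ≠ 0 := by
    rw [det_of_isLowerTriangular _ hVtri, Finset.prod_ne_zero_iff] at hdet
    exact fun i => hdet i (Finset.mem_univ i)
  have hDpos : ∀ i, 0 < LDL.diagEntries hA i := by
    have h1 : (LDL.diag hA).PosDef := by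
      rw [LDL.diag_eq_lowerInv_conj]
      refine hA.mul_mul_conjTranspose_same ?_
      exact vecMul_injective_of_isUnit (isUnit_of_invertible _)
    intro i
    rw [LDL.diag] at h1
    exact (posDef_diagonal_iff.1 h1) i
  set D := LDL.diagEntries hA with hD
  -- The diagonal of the triangular factor `W⁻¹` is only known to be nonzero. Multiplying each
  -- column by the sign of its diagonal entry makes the diagonal positive, and these signs square to
  -- one in `L * Lᵀ`.
  set e : Fin p → ℝ := fun i => SignType.sign (W⁻¹ i i) * √(D i) with he
  refine ⟨W⁻¹ * diagonal e, ?_, ?_, ?_⟩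
  · intro i j hij
    rw [mul_diagonal, hVtri (OrderDual.toDual_lt_toDual.2 hij), zero_mul]
  · intro i
    rw [mul_diagonal, he]
    have : W⁻¹ i i * (SignType.sign (W⁻¹ i i) : ℝ) = |W⁻¹ i i| := by
      rw [self_mul_sign]
    simp only []
    rw [← mul_assoc, this]
    exact mul_pos (abs_pos.2 (hVdiag i)) (Real.sqrt_pos.2 (hDpos i))
  · have hee : diagonal e * diagonal e = LDL.diag hA := by
      rw [diagonal_mul_diagonal, LDL.diag]
      congr 1
      funext i
      have hs : ((SignType.sign (W⁻¹ i i) : ℝ)) * (SignType.sign (W⁻¹ i i) : ℝ) = 1 := by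
        rcases lt_or_gt_of_ne (hVdiag i) with h | h <;> simp [h]
      calc e i * e i = ((SignType.sign (W⁻¹ i i) : ℝ) * (SignType.sign (W⁻¹ i i) : ℝ))
            * (√(D i) * √(D i)) := by simp only [he]; ring
        _ = D i := by rw [hs, one_mul, Real.mul_self_sqrt (hDpos i).le]
    calc W⁻¹ * diagonal e * (W⁻¹ * diagonal e)ᵀ
        = W⁻¹ * (diagonal e * diagonal e) * W⁻¹ᵀ := by
          rw [transpose_mul, diagonal_transpose]; simp only [Matrix.mul_assoc]
      _ = A := by
          rw [hee]
          have := LDL.lower_conj_diag hA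
          rwa [conjTranspose_eq_transpose_of_trivial] at this

theorem isCholeskyFactor_choleskyFactor {p : ℕ} {A : Matrix (Fin p) (Fin p) ℝ} (hA : A.PosDef) :
    IsCholeskyFactor (choleskyFactor A) A := by
  have h := exists_isCholeskyFactor hA
  rw [choleskyFactor, dif_pos h]
  exact h.choose_spec

open Matrix in
theorem IsCholeskyFactor.det_pos {p : ℕ} {L A : Matrix (Fin p) (Fin p) ℝ}
    (h : IsCholeskyFactor L A) : 0 < L.det := by
  have hL : L.BlockTriangular OrderDual.toDual := fun i j hij => h.1 i j hij
  rw [det_of_isLowerTriangular _ hL]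
  exact Finset.prod_pos fun i _ => h.2.1 i

open Matrix in
theorem sq_norm_eq_dotProduct {p : ℕ} (v : Param p) :
    ‖v‖ ^ 2 = (fun i => v i) ⬝ᵥ (fun i => v i) := by
  rw [EuclideanSpace.norm_sq_eq]
  simp [dotProduct, sq]

open Matrix in
/-- The quadratic form of a symmetric matrix is controlled by its spectrum. -/
theorem quadForm_mem_Icc_of_spectrum {p : ℕ} {H : Matrix (Fin p) (Fin p) ℝ} (hH : H.IsHermitian)
    {a b : ℝ} (hspec : ∀ μ ∈ spectrum ℝ H, a ≤ μ ∧ μ ≤ b) (v : Param p) :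
    a * ‖v‖ ^ 2 ≤ (fun i => v i) ⬝ᵥ (H *ᵥ fun i => v i) ∧
      (fun i => v i) ⬝ᵥ (H *ᵥ fun i => v i) ≤ b * ‖v‖ ^ 2 := by
  set U : Matrix (Fin p) (Fin p) ℝ := hH.eigenvectorUnitary.1 with hU
  have hUU : U * star U = 1 := by simp [hU]
  have hspecthm : H = U * diagonal hH.eigenvalues * star U := by
    have := hH.spectral_theorem
    rw [Unitary.conjStarAlgAut_apply] at this
    exact this
  set w : Fin p → ℝ := star U *ᵥ (fun i => v i) with hw
  have hUt : star U = Uᵀ := by rw [star_eq_conjTranspose, conjTranspose_eq_transpose_of_trivial]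
  have hw' : w = (fun i => v i) ᵥ* U := by rw [hw, hUt, mulVec_transpose]
  have hq : (fun i => v i) ⬝ᵥ (H *ᵥ fun i => v i) = ∑ i, hH.eigenvalues i * w i ^ 2 := by
    conv_lhs => rw [hspecthm]
    rw [← mulVec_mulVec, ← mulVec_mulVec, dotProduct_mulVec, ← hw', ← hw, dotProduct]
    refine Finset.sum_congr rfl fun i _ => ?_
    rw [mulVec_diagonal]; ring
  have hn : ‖v‖ ^ 2 = ∑ i, w i ^ 2 := by
    have : w ⬝ᵥ w = (fun i => v i) ⬝ᵥ (fun i => v i) := by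
      conv_lhs => rw [hw', ← dotProduct_mulVec, ← hw', hw, mulVec_mulVec, hUU, one_mulVec]
    rw [sq_norm_eq_dotProduct, ← this, dotProduct]
    exact Finset.sum_congr rfl fun i _ => (sq _).symm
  rw [hq, hn, Finset.mul_sum, Finset.mul_sum]
  constructor <;> refine Finset.sum_le_sum fun i _ => ?_
  · exact mul_le_mul_of_nonneg_right (hspec _ (hH.eigenvalues_mem_spectrum_real i)).1 (sq_nonneg _)
  · exact mul_le_mul_of_nonneg_right (hspec _ (hH.eigenvalues_mem_spectrum_real i)).2 (sq_nonneg _)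

/-- Multiplication by a matrix as a continuous linear map of the Euclidean space. -/
def matrixMap {p : ℕ} (L : Matrix (Fin p) (Fin p) ℝ) : Param p →L[ℝ] Param p :=
  (Matrix.toLpLin 2 2 L).toContinuousLinearMap

theorem matrixMap_apply {p : ℕ} (L : Matrix (Fin p) (Fin p) ℝ) (z : Param p) :
    matrixMap L z = WithLp.toLp 2 (L.mulVec fun i => z i) := rfl

theorem det_matrixMap {p : ℕ} (L : Matrix (Fin p) (Fin p) ℝ) : (matrixMap L).det = L.det := by
  rw [ContinuousLinearMap.det]
  exact LinearMap.det_toLpLin 2 L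

open Matrix in
/-- For `H` with spectrum in `[a, b]`, the Cholesky factor `L` of `H⁻¹` has positive determinant,
satisfies `a |L z|² ≤ |z|² ≤ b |L z|²`, and turns `H` into the identity. -/
theorem choleskyFactor_inv_spec {p : ℕ} {H : Matrix (Fin p) (Fin p) ℝ} (hH : H.IsHermitian)
    {a b : ℝ} (ha : 0 < a) (hspec : ∀ μ ∈ spectrum ℝ H, a ≤ μ ∧ μ ≤ b) :
    0 < (choleskyFactor H⁻¹).det ∧ 1 ≤ (choleskyFactor H⁻¹).det ^ 2 * b ^ p ∧
    (∀ z, a * ‖matrixMap (choleskyFactor H⁻¹) z‖ ^ 2 ≤ ‖z‖ ^ 2) ∧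
    (∀ z, ‖z‖ ^ 2 ≤ b * ‖matrixMap (choleskyFactor H⁻¹) z‖ ^ 2) ∧
    ∀ z : Param p, (fun i => matrixMap (choleskyFactor H⁻¹) z i) ⬝ᵥ
      (H *ᵥ fun i => matrixMap (choleskyFactor H⁻¹) z i) = ‖z‖ ^ 2 := by
  have hpos : H.PosDef := hH.posDef_iff_eigenvalues_pos.2 fun i =>
    ha.trans_le (hspec _ (hH.eigenvalues_mem_spectrum_real i)).1
  have hL := isCholeskyFactor_choleskyFactor hpos.inv
  set L := choleskyFactor H⁻¹
  have hLdet := hL.det_pos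
  have hHdet : 0 < H.det := hpos.det_pos
  -- `L Lᵀ = H⁻¹` makes `Lᵀ H` a right inverse of `L`, hence a left inverse. This identity yields
  -- both the isometry property and the determinant bound below.
  have hLHL : Lᵀ * H * L = 1 := by
    have h1 : L * (Lᵀ * H) = 1 := by
      rw [← Matrix.mul_assoc, hL.2.2, nonsing_inv_mul _ (isUnit_iff_ne_zero.2 hHdet.ne')]
    exact mul_eq_one_comm.1 h1
  have hid : ∀ z : Param p, (fun i => matrixMap L z i) ⬝ᵥ
      (H *ᵥ fun i => matrixMap L z i) = ‖z‖ ^ 2 := by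
    intro z
    have hz : (fun i => matrixMap L z i) = L *ᵥ (fun i => z i) := rfl
    rw [hz, sq_norm_eq_dotProduct, dotProduct_comm, dotProduct_mulVec, ← mulVec_transpose,
      mulVec_mulVec, mulVec_mulVec, hLHL, one_mulVec]
  refine ⟨hLdet, ?_, fun z => ?_, fun z => ?_, hid⟩
  · have h2 : L.det ^ 2 * H.det = 1 := by
      have := congrArg Matrix.det hLHL
      rw [det_mul, det_mul, det_transpose, det_one] at this
      linarith
    have h3 : H.det ≤ b ^ p := by
      rw [hH.det_eq_prod_eigenvalues]
      calc ∏ i, hH.eigenvalues i ≤ ∏ _i : Fin p, b :=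
            Finset.prod_le_prod (fun i _ => (hpos.eigenvalues_pos i).le)
              (fun i _ => (hspec _ (hH.eigenvalues_mem_spectrum_real i)).2)
        _ = b ^ p := by simp
    rw [← h2]
    gcongr
  · rw [← hid z]
    exact (quadForm_mem_Icc_of_spectrum hH hspec _).1
  · conv_lhs => rw [← hid z]
    exact (quadForm_mem_Icc_of_spectrum hH hspec _).2

/-! ### Gaussian integrals of polynomially bounded functions -/

theorem integrable_one_add_norm_pow_mul_exp {p : ℕ} {c : ℝ} (hc : 0 < c) (K : ℕ) :
    Integrable fun z : Param p => (1 + ‖z‖) ^ K * Real.exp (-(c * ‖z‖ ^ 2)) := by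
  have hbase : Integrable fun z : Param p => Real.exp (-(c / 2 * ‖z‖ ^ 2)) := by
    have h := (GaussianFourier.integrable_cexp_neg_mul_sq_norm_add (V := Param p)
      (b := ((c / 2 : ℝ) : ℂ)) (by simpa using hc) 0 0).norm
    refine h.congr (Eventually.of_forall fun z => ?_)
    simp [Complex.norm_exp, ← Complex.ofReal_pow]
  -- The power is at most `K! exp(1 + ‖z‖)`, and completing the square absorbs the linear exponent
  -- into half of the Gaussian.
  refine (hbase.const_mul (K.factorial * Real.exp (1 + 1 / (2 * c)))).mono'
    (by fun_prop) (Eventually.of_forall fun z => ?_)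
  rw [Real.norm_of_nonneg (by positivity)]
  have h1 : (1 + ‖z‖) ^ K ≤ K.factorial * Real.exp (1 + ‖z‖) := by
    have := Real.pow_div_factorial_le_exp (1 + ‖z‖) (by positivity) K
    rwa [div_le_iff₀' (by positivity)] at this
  calc (1 + ‖z‖) ^ K * Real.exp (-(c * ‖z‖ ^ 2))
      ≤ K.factorial * Real.exp (1 + ‖z‖) * Real.exp (-(c * ‖z‖ ^ 2)) := by gcongr
    _ = K.factorial * Real.exp (1 + ‖z‖ + -(c * ‖z‖ ^ 2)) := by rw [mul_assoc, ← Real.exp_add]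
    _ ≤ K.factorial * Real.exp (1 + 1 / (2 * c) + -(c / 2 * ‖z‖ ^ 2)) := by
        gcongr ?_ * Real.exp ?_
        have : 0 ≤ c / 2 * (‖z‖ - 1 / c) ^ 2 := by positivity
        have h2 : c / 2 * (‖z‖ - 1 / c) ^ 2 = c / 2 * ‖z‖ ^ 2 - ‖z‖ + 1 / (2 * c) := by
          field_simp; ring
        linarith
    _ = _ := by rw [Real.exp_add]; ring

/-- The unnormalized standard Gaussian weight. -/
def gaussWeight {p : ℕ} (z : Param p) : ℝ := Real.exp (-(1 / 2 * ‖z‖ ^ 2))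

theorem gaussWeight_pos {p : ℕ} (z : Param p) : 0 < gaussWeight z := Real.exp_pos _

theorem gaussWeight_neg {p : ℕ} (z : Param p) : gaussWeight (-z) = gaussWeight z := by
  simp [gaussWeight]

theorem continuous_gaussWeight {p : ℕ} : Continuous (gaussWeight (p := p)) := by
  unfold gaussWeight; fun_prop

theorem integrable_gaussWeight_mul_of_le {p : ℕ} {f : Param p → ℝ} (hf : Continuous f) {A : ℝ}
    {K : ℕ} (hA : ∀ z, |f z| ≤ A * (1 + ‖z‖) ^ K) : Integrable fun z => gaussWeight z * f z := by
  refine ((integrable_one_add_norm_pow_mul_exp (p := p) one_half_pos K).const_mul A).mono'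
    (continuous_gaussWeight.mul hf).aestronglyMeasurable (Eventually.of_forall fun z => ?_)
  rw [norm_mul, Real.norm_of_nonneg (gaussWeight_pos z).le, Real.norm_eq_abs, mul_comm]
  calc |f z| * gaussWeight z ≤ A * (1 + ‖z‖) ^ K * gaussWeight z :=
        mul_le_mul_of_nonneg_right (hA z) (gaussWeight_pos z).le
    _ = _ := by rw [gaussWeight]; ring

/-! ### Quadrature errors -/

/-- The error of the rule `R` for the integral of `f` against the Gaussian weight. -/
def QuadRule.error {p : ℕ} (R : QuadRule p) (f : Param p → ℝ) : ℝ :=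
  (∫ z, gaussWeight z * f z) - ∑ z ∈ R.points, gaussWeight z * f z * R.weight z

/-- Bound for the error of `R` on functions bounded by `(1 + |z|)^K`. -/
def QuadRule.errorBound {p : ℕ} (R : QuadRule p) (K : ℕ) : ℝ :=
  (∫ z : Param p, gaussWeight z * (1 + ‖z‖) ^ K)
    + ∑ z ∈ R.points, gaussWeight z * (1 + ‖z‖) ^ K * |R.weight z|

theorem QuadRule.errorBound_nonneg {p : ℕ} (R : QuadRule p) (K : ℕ) : 0 ≤ R.errorBound K := by
  refine add_nonneg (integral_nonneg fun z => ?_) (Finset.sum_nonneg fun z _ => ?_)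
  · have := gaussWeight_pos z
    simp only [Pi.zero_apply]; positivity
  · have := gaussWeight_pos z
    positivity

theorem QuadRule.abs_error_le {p : ℕ} (R : QuadRule p) {f : Param p → ℝ} {A : ℝ} {K : ℕ}
    (hA : ∀ z, |f z| ≤ A * (1 + ‖z‖) ^ K) : |R.error f| ≤ A * R.errorBound K := by
  have hpt : ∀ z, |gaussWeight z * f z| ≤ A * (gaussWeight z * (1 + ‖z‖) ^ K) := by
    intro z
    rw [abs_mul, abs_of_pos (gaussWeight_pos z)]
    calc gaussWeight z * |f z| ≤ gaussWeight z * (A * (1 + ‖z‖) ^ K) :=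
          mul_le_mul_of_nonneg_left (hA z) (gaussWeight_pos z).le
      _ = _ := by ring
  have hint : Integrable fun z : Param p => gaussWeight z * (1 + ‖z‖) ^ K :=
    integrable_gaussWeight_mul_of_le (by fun_prop) (A := 1) (K := K)
      (fun z => by rw [abs_of_nonneg (by positivity), one_mul])
  refine (abs_sub _ _).trans ?_
  rw [QuadRule.errorBound, mul_add]
  refine add_le_add ?_ ?_
  · rw [← integral_const_mul, ← Real.norm_eq_abs]
    exact norm_integral_le_of_norm_le (hint.const_mul A) (Eventually.of_forall hpt)
  · rw [Finset.mul_sum]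
    refine (Finset.abs_sum_le_sum_abs _ _).trans (Finset.sum_le_sum fun z _ => ?_)
    rw [abs_mul, ← mul_assoc]
    exact mul_le_mul_of_nonneg_right (hpt z) (abs_nonneg _)

theorem QuadRule.error_sum {p : ℕ} (R : QuadRule p) {ι : Type*} (S : Finset ι)
    (f : ι → Param p → ℝ) (hf : ∀ i ∈ S, Integrable fun z => gaussWeight z * f i z) :
    R.error (fun z => ∑ i ∈ S, f i z) = ∑ i ∈ S, R.error (f i) := by
  unfold QuadRule.error
  simp_rw [Finset.mul_sum, Finset.sum_mul]
  rw [integral_finsetSum S hf, Finset.sum_comm, Finset.sum_sub_distrib]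

theorem QuadRule.error_const_mul {p : ℕ} (R : QuadRule p) (a : ℝ) (f : Param p → ℝ) :
    R.error (fun z => a * f z) = a * R.error f := by
  unfold QuadRule.error
  rw [mul_sub, ← integral_const_mul, Finset.mul_sum]
  congr 1
  · congr 1; funext z; ring
  · exact Finset.sum_congr rfl fun z _ => by ring

/-- Under `z ↦ -z` both the integral and the sum equal their own negatives. -/
theorem QuadRule.error_eq_zero_of_odd {p : ℕ} {R : QuadRule p} (hR : R.IsSymmetric)
    {f : Param p → ℝ} (hf : ∀ z, f (-z) = -f z) : R.error f = 0 := by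
  have h1 : ∫ z, gaussWeight z * f z = 0 := by
    have := integral_neg_eq_self (fun z : Param p => gaussWeight z * f z) volume
    simp_rw [gaussWeight_neg, hf, mul_neg] at this
    rw [integral_neg] at this
    linarith
  have h2 : ∑ z ∈ R.points, gaussWeight z * f z * R.weight z = 0 := by
    have : ∑ z ∈ R.points, gaussWeight z * f z * R.weight z
        = ∑ z ∈ R.points, -(gaussWeight z * f z * R.weight z) := by
      refine Finset.sum_nbij' (fun z => -z) (fun z => -z) (fun z hz => (hR z hz).1)
        (fun z hz => (hR z hz).1) (by simp) (by simp) fun z hz => ?_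
      rw [gaussWeight_neg, hf, ← (hR z hz).2]
      ring
    rw [Finset.sum_neg_distrib] at this
    linarith
  rw [QuadRule.error, h1, h2, sub_zero]

/-- Exactness is stated for the normalized density; the normalizing factor is common to both sides
and cancels. -/
theorem QuadRule.IsExact.error_eval_eq_zero {p k : ℕ} {R : QuadRule p} (hR : R.IsExact k)
    {f : MvPolynomial (Fin p) ℝ} (hf : f.totalDegree < 2 * k) :
    R.error (fun z => MvPolynomial.eval (fun i => z i) f) = 0 := by
  have h := hR f hf
  have hc : (2 * Real.pi) ^ (-(p : ℝ) / 2) ≠ 0 := by positivity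
  have hd : ∀ z : Param p,
      stdNormalDensity z = (2 * Real.pi) ^ (-(p : ℝ) / 2) * gaussWeight z := by
    intro z
    rw [stdNormalDensity, gaussWeight]
    congr 2; ring
  simp_rw [hd, mul_assoc] at h
  rw [integral_const_mul, ← Finset.mul_sum, mul_right_inj' hc] at h
  rw [QuadRule.error, h]
  simp_rw [mul_assoc, sub_self]

theorem eval_neg_of_isHomogeneous {p D : ℕ} {f : MvPolynomial (Fin p) ℝ} (hf : f.IsHomogeneous D)
    (z : Param p) : MvPolynomial.eval (fun i => (-z) i) f =
      (-1) ^ D * MvPolynomial.eval (fun i => z i) f := by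
  rw [MvPolynomial.eval_eq, MvPolynomial.eval_eq, Finset.mul_sum]
  refine Finset.sum_congr rfl fun d hd => ?_
  rw [hf.degree_eq_sum_deg_support hd, ← Finset.prod_pow_eq_pow_sum, mul_left_comm,
    ← Finset.prod_mul_distrib]
  congr 1
  refine Finset.prod_congr rfl fun i _ => ?_
  rw [← mul_pow]
  simp

theorem continuous_eval_coords {p : ℕ} (f : MvPolynomial (Fin p) ℝ) :
    Continuous fun z : Param p => MvPolynomial.eval (fun i => z i) f :=
  (MvPolynomial.continuous_eval f).comp (by fun_prop)

/-- The quadrature error of a homogeneous polynomial of degree `D` and size `ε^r`, where `D` and `r`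
have the same parity and `D ≤ 3 r`: either the polynomial is odd, or it is integrated exactly, or it
is small. -/
theorem QuadRule.abs_error_homogeneous_le {p k : ℕ} {R : QuadRule p} (hsymm : R.IsSymmetric)
    (hexact : R.IsExact k) {f : MvPolynomial (Fin p) ℝ} {D r K : ℕ}
    (hf : f.IsHomogeneous D) (hDr : D ≤ 3 * r) (hpar : D % 2 = r % 2) (hDK : D ≤ K) {A ε : ℝ}
    (hA : 0 ≤ A) (hε0 : 0 ≤ ε) (hε1 : ε ≤ 1)
    (hbound : ∀ z : Param p, |MvPolynomial.eval (fun i => z i) f| ≤ A * ε ^ r * ‖z‖ ^ D) :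
    |R.error (fun z => MvPolynomial.eval (fun i => z i) f)| ≤
      A * ε ^ (2 * ((k + 2) / 3)) * R.errorBound K := by
  have hnn : 0 ≤ A * ε ^ (2 * ((k + 2) / 3)) * R.errorBound K :=
    mul_nonneg (by positivity) (R.errorBound_nonneg K)
  rcases Nat.even_or_odd r with hr | hr
  · rcases lt_or_ge r (2 * ((k + 2) / 3)) with hlt | hge
    -- With `s = (k + 2) / 3`, an even `r < 2s` satisfies `r ≤ 2s - 2`, so `D ≤ 6s - 6 ≤ 2k - 2`
    -- because `3s ≤ k + 2`.
    · have hdeg : f.totalDegree < 2 * k := by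
        have := hf.totalDegree_le
        obtain ⟨q, hq⟩ := hr
        omega
      rw [hexact.error_eval_eq_zero hdeg, abs_zero]
      exact hnn
    · refine R.abs_error_le fun z => (hbound z).trans ?_
      have h1 : ε ^ r ≤ ε ^ (2 * ((k + 2) / 3)) := pow_le_pow_of_le_one hε0 hε1 hge
      have h2 : ‖z‖ ^ D ≤ (1 + ‖z‖) ^ K :=
        (pow_le_pow_left₀ (norm_nonneg _) (by linarith) D).trans
          (pow_le_pow_right₀ (by linarith [norm_nonneg z]) hDK)
      gcongr
  · have hD : Odd D := by
      rw [Nat.odd_iff] at hr ⊢; omega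
    rw [QuadRule.error_eq_zero_of_odd hsymm, abs_zero]
    · exact hnn
    · intro z
      rw [eval_neg_of_isHomogeneous hf, hD.neg_one_pow, neg_one_mul]

/-- The quadrature error of the truncated exponential of a sum of homogeneous polynomials `T j` of
degree `j` and size `ε ^ (j - 2)`. -/
theorem QuadRule.abs_error_expansion_le {p k : ℕ} {R : QuadRule p} (hsymm : R.IsSymmetric)
    (hexact : R.IsExact k) (N n : ℕ) {A : ℝ} (hA : 0 ≤ A) :
    ∃ C : ℝ, 0 ≤ C ∧ ∀ (T : ℕ → MvPolynomial (Fin p) ℝ) (ε : ℝ), 0 ≤ ε → ε ≤ 1 →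
      (∀ j ∈ Finset.Ico 3 N, (T j).IsHomogeneous j) →
      (∀ j ∈ Finset.Ico 3 N, ∀ z : Param p,
        |MvPolynomial.eval (fun i => z i) (T j)| ≤ A * ε ^ (j - 2) * ‖z‖ ^ j) →
      |R.error (fun z => ∑ t ∈ Finset.range n,
        (∑ j ∈ Finset.Ico 3 N, MvPolynomial.eval (fun i => z i) (T j)) ^ t / t.factorial)| ≤
        C * ε ^ (2 * ((k + 2) / 3)) := by
  set J := Finset.Ico 3 N with hJ
  -- One summand for each tuple of degrees. Every product has degree at most `n * N`, so a single
  -- `errorBound` serves them all.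
  refine ⟨∑ t ∈ Finset.range n, ∑ _x ∈ Fintype.piFinset (fun _ : Fin t => J),
    A ^ t * R.errorBound (n * N), ?_, ?_⟩
  · exact Finset.sum_nonneg fun t _ => Finset.sum_nonneg fun x _ =>
      mul_nonneg (by positivity) (R.errorBound_nonneg _)
  intro T ε hε0 hε1 hhom hbound
  set P : (t : ℕ) → (Fin t → ℕ) → MvPolynomial (Fin p) ℝ := fun t x => ∏ i, T (x i) with hP
  have hPhom : ∀ t, ∀ x ∈ Fintype.piFinset (fun _ : Fin t => J),
      (P t x).IsHomogeneous (∑ i, x i) := fun t x hx =>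
    MvPolynomial.IsHomogeneous.prod _ _ _ fun i _ => hhom _ (Fintype.mem_piFinset.1 hx i)
  have hPbound : ∀ t, ∀ x ∈ Fintype.piFinset (fun _ : Fin t => J), ∀ z : Param p,
      |MvPolynomial.eval (fun i => z i) (P t x)| ≤
        A ^ t * ε ^ (∑ i, (x i - 2)) * ‖z‖ ^ (∑ i, x i) := by
    intro t x hx z
    rw [hP, map_prod, Finset.abs_prod]
    calc ∏ i, |MvPolynomial.eval (fun i => z i) (T (x i))|
        ≤ ∏ i, (A * ε ^ (x i - 2) * ‖z‖ ^ (x i)) :=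
          Finset.prod_le_prod (fun _ _ => abs_nonneg _)
            fun i _ => hbound _ (Fintype.mem_piFinset.1 hx i) z
      _ = _ := by
          rw [Finset.prod_mul_distrib, Finset.prod_mul_distrib, Finset.prod_pow_eq_pow_sum,
            Finset.prod_pow_eq_pow_sum]
          simp
  have hexp : (fun z : Param p => ∑ t ∈ Finset.range n,
        (∑ j ∈ J, MvPolynomial.eval (fun i => z i) (T j)) ^ t / t.factorial) =
      fun z => ∑ t ∈ Finset.range n, ∑ x ∈ Fintype.piFinset (fun _ : Fin t => J),
        (t.factorial : ℝ)⁻¹ * MvPolynomial.eval (fun i => z i) (P t x) := by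
    funext z
    refine Finset.sum_congr rfl fun t _ => ?_
    rw [Finset.sum_pow', ← Finset.mul_sum, div_eq_inv_mul]
    congr 1
    exact Finset.sum_congr rfl fun x _ => by rw [hP, map_prod]
  have hint : ∀ t, ∀ x ∈ Fintype.piFinset (fun _ : Fin t => J), Integrable fun z : Param p =>
      gaussWeight z * ((t.factorial : ℝ)⁻¹ * MvPolynomial.eval (fun i => z i) (P t x)) := by
    intro t x hx
    refine integrable_gaussWeight_mul_of_le (A := (t.factorial : ℝ)⁻¹ *
      (A ^ t * ε ^ (∑ i, (x i - 2)))) (K := ∑ i, x i)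
      (continuous_const.mul (continuous_eval_coords _)) fun z => ?_
    rw [abs_mul, abs_of_pos (by positivity : (0 : ℝ) < (t.factorial : ℝ)⁻¹), mul_assoc]
    refine mul_le_mul_of_nonneg_left ((hPbound t x hx z).trans ?_) (by positivity)
    gcongr
    linarith
  rw [hexp, QuadRule.error_sum, Finset.sum_mul]
  · refine (Finset.abs_sum_le_sum_abs _ _).trans (Finset.sum_le_sum fun t ht => ?_)
    rw [QuadRule.error_sum _ _ _ (hint t), Finset.sum_mul]
    refine (Finset.abs_sum_le_sum_abs _ _).trans (Finset.sum_le_sum fun x hx => ?_)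
    rw [QuadRule.error_const_mul, abs_mul, abs_of_pos (by positivity : (0 : ℝ) < (t.factorial : ℝ)⁻¹)]
    have hxi : ∀ i, 3 ≤ x i ∧ x i < N := fun i =>
      Finset.mem_Ico.1 (Fintype.mem_piFinset.1 hx i)
    -- A factor of degree `j` carries `ε ^ (j - 2)`, so degree and order differ by `2t`. Since `t`
    -- is at most the order, this gives the parity condition and `D ≤ 3 r`.
    have hD : ∑ i, x i = ∑ i, (x i - 2) + 2 * t := by
      have : ∑ i, x i = ∑ i, ((x i - 2) + 2) :=
        Finset.sum_congr rfl fun i _ => by have := hxi i; omega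
      rw [this, Finset.sum_add_distrib]
      simp [mul_comm]
    have ht' : t ≤ ∑ i, (x i - 2) := by
      calc t = ∑ _i : Fin t, 1 := by simp
        _ ≤ _ := Finset.sum_le_sum fun i _ => by have := hxi i; omega
    have hDK : ∑ i, x i ≤ n * N := by
      calc ∑ i, x i ≤ ∑ _i : Fin t, N := Finset.sum_le_sum fun i _ => (hxi i).2.le
        _ = t * N := by simp
        _ ≤ n * N := Nat.mul_le_mul_right _ (Finset.mem_range.1 ht).le
    have key := QuadRule.abs_error_homogeneous_le hsymm hexact (hPhom t x hx)
      (r := ∑ i, (x i - 2)) (by omega) (by omega) hDK (by positivity : 0 ≤ A ^ t) hε0 hε1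
      (hPbound t x hx)
    have hfac : (t.factorial : ℝ)⁻¹ ≤ 1 :=
      inv_le_one_of_one_le₀ (by exact_mod_cast t.factorial_pos)
    calc _ ≤ 1 * |R.error (fun z => MvPolynomial.eval (fun i => z i) (P t x))| :=
          mul_le_mul_of_nonneg_right hfac (abs_nonneg _)
      _ ≤ _ := by rw [one_mul]; linarith
  · intro t _
    simp_rw [Finset.mul_sum]
    exact integrable_finsetSum _ (hint t)

/-! ### Pointwise comparison with the truncated expansion -/

/-- Here `x` plays the norm of `z`, `f` the exact non-Gaussian exponent and `T` its Taylor
polynomial. Truncating the exponential series of `f` costs `|f| ^ (2s)`, and passing from `f` to `T`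
in the truncated series costs a multiple of `|f - T|`; both are of order `ε ^ (2s)`. The one-sided
bound on `f` gives `max 1 (exp f) * exp(-x²/2) ≤ exp(-c x²/2)`. The power `8s + 2` is `2s + 2` from
`f - T` plus `6s` from powers of cubic bounds. -/
theorem abs_exp_sub_expansion_le {s : ℕ} {A c ε x f T : ℝ} (hA : 0 ≤ A) (hc1 : c ≤ 1)
    (hε0 : 0 ≤ ε) (hε1 : ε ≤ 1) (hx : 0 ≤ x) (hfT : |f - T| ≤ A * ε ^ (2 * s) * x ^ (2 * s + 2))
    (hf : |f| ≤ A * ε * x ^ 3) (hT : |T| ≤ A * ε * x ^ 3) (hfle : f ≤ (1 - c) / 2 * x ^ 2) :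
    |Real.exp (f - 1 / 2 * x ^ 2) - Real.exp (-(1 / 2 * x ^ 2)) *
        ∑ t ∈ Finset.range (2 * s), T ^ t / t.factorial| ≤
      ((2 * s + 3) * A ^ (2 * s) + 2 * s * (2 * s * A * (1 + A) ^ (2 * s))) *
        ε ^ (2 * s) * (1 + x) ^ (8 * s + 2) * Real.exp (-(c / 2 * x ^ 2)) := by
  have h1x : 1 ≤ 1 + x := by linarith
  have hxle : x ≤ 1 + x := by linarith
  set S := ∑ t ∈ Finset.range (2 * s), f ^ t / t.factorial with hS
  set S' := ∑ t ∈ Finset.range (2 * s), T ^ t / t.factorial with hS'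
  have hw : max 1 (Real.exp f) * Real.exp (-(1 / 2 * x ^ 2)) ≤ Real.exp (-(c / 2 * x ^ 2)) := by
    rw [max_mul_of_nonneg _ _ (Real.exp_pos _).le, one_mul, ← Real.exp_add]
    refine max_le (Real.exp_le_exp.2 ?_) (Real.exp_le_exp.2 ?_) <;> nlinarith [sq_nonneg x]
  have hw' : Real.exp (-(1 / 2 * x ^ 2)) ≤ Real.exp (-(c / 2 * x ^ 2)) :=
    Real.exp_le_exp.2 (by nlinarith [sq_nonneg x])
  have hfirst : |Real.exp f - S| * Real.exp (-(1 / 2 * x ^ 2)) ≤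
      (2 * s + 3) * A ^ (2 * s) * ε ^ (2 * s) * (1 + x) ^ (8 * s + 2) *
        Real.exp (-(c / 2 * x ^ 2)) := by
    have h := abs_exp_sub_sum_le (2 * s) f
    push_cast at h
    have hp : |f| ^ (2 * s) ≤ A ^ (2 * s) * ε ^ (2 * s) * (1 + x) ^ (8 * s + 2) := by
      calc |f| ^ (2 * s) ≤ (A * ε * x ^ 3) ^ (2 * s) := by gcongr
        _ = A ^ (2 * s) * ε ^ (2 * s) * x ^ (6 * s) := by
            rw [mul_pow, mul_pow, ← pow_mul]; ring_nf
        _ ≤ A ^ (2 * s) * ε ^ (2 * s) * (1 + x) ^ (8 * s + 2) := by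
            gcongr
            exact (pow_le_pow_left₀ hx hxle _).trans (pow_le_pow_right₀ h1x (by omega))
    calc |Real.exp f - S| * Real.exp (-(1 / 2 * x ^ 2))
        ≤ (2 * s + 3) * |f| ^ (2 * s) * max 1 (Real.exp f) * Real.exp (-(1 / 2 * x ^ 2)) := by
          gcongr
      _ = (2 * s + 3) * |f| ^ (2 * s) * (max 1 (Real.exp f) * Real.exp (-(1 / 2 * x ^ 2))) := by
          ring
      _ ≤ (2 * s + 3) * (A ^ (2 * s) * ε ^ (2 * s) * (1 + x) ^ (8 * s + 2)) *
          Real.exp (-(c / 2 * x ^ 2)) := by gcongr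
      _ = _ := by ring
  have hsecond : |S - S'| ≤
      2 * s * (2 * s * A * (1 + A) ^ (2 * s)) * ε ^ (2 * s) * (1 + x) ^ (8 * s + 2) := by
    rw [hS, hS', ← Finset.sum_sub_distrib]
    refine (Finset.abs_sum_le_sum_abs _ _).trans ?_
    have hterm : ∀ t ∈ Finset.range (2 * s), |f ^ t / t.factorial - T ^ t / t.factorial| ≤
        2 * s * A * (1 + A) ^ (2 * s) * ε ^ (2 * s) * (1 + x) ^ (8 * s + 2) := by
      intro t ht
      have ht' := Finset.mem_range.1 ht
      have hfac : (1 : ℝ) ≤ t.factorial := by exact_mod_cast t.factorial_pos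
      rw [← sub_div, abs_div, abs_of_pos (by positivity : (0 : ℝ) < t.factorial)]
      refine (div_le_self (abs_nonneg _) hfac).trans ((abs_pow_sub_pow_le f T t).trans ?_)
      have hm : max |f| |T| ≤ (1 + A) * (1 + x) ^ 3 := by
        refine (max_le hf hT).trans ?_
        calc A * ε * x ^ 3 ≤ A * 1 * (1 + x) ^ 3 := by gcongr
          _ ≤ (1 + A) * (1 + x) ^ 3 := by
            rw [mul_one]; gcongr; linarith
      have hm' : max |f| |T| ^ (t - 1) ≤ (1 + A) ^ (2 * s) * (1 + x) ^ (6 * s) := by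
        have hb : 1 ≤ (1 + A) * (1 + x) ^ 3 :=
          one_le_mul_of_one_le_of_one_le (by linarith) (one_le_pow₀ h1x)
        calc max |f| |T| ^ (t - 1) ≤ ((1 + A) * (1 + x) ^ 3) ^ (t - 1) := by gcongr
          _ ≤ ((1 + A) * (1 + x) ^ 3) ^ (2 * s) := pow_le_pow_right₀ hb (by omega)
          _ = _ := by rw [mul_pow, ← pow_mul]; ring_nf
      have ht2 : (t : ℝ) ≤ 2 * s := by exact_mod_cast ht'.le
      calc |f - T| * t * max |f| |T| ^ (t - 1)
          ≤ (A * ε ^ (2 * s) * (1 + x) ^ (2 * s + 2)) * (2 * s) *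
            ((1 + A) ^ (2 * s) * (1 + x) ^ (6 * s)) := by
              have : |f - T| ≤ A * ε ^ (2 * s) * (1 + x) ^ (2 * s + 2) := hfT.trans (by gcongr)
              gcongr
        _ = _ := by ring
    refine (Finset.sum_le_sum hterm).trans (le_of_eq ?_)
    rw [Finset.sum_const, Finset.card_range, nsmul_eq_mul]
    push_cast
    ring
  have hsplit : Real.exp (f - 1 / 2 * x ^ 2) - Real.exp (-(1 / 2 * x ^ 2)) * S' =
      (Real.exp f - S) * Real.exp (-(1 / 2 * x ^ 2)) + (S - S') * Real.exp (-(1 / 2 * x ^ 2)) := by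
    rw [sub_eq_add_neg f, Real.exp_add]; ring
  rw [hsplit]
  refine (abs_add_le _ _).trans ?_
  rw [abs_mul, abs_mul, abs_of_pos (Real.exp_pos _)]
  have h2 : |S - S'| * Real.exp (-(1 / 2 * x ^ 2)) ≤
      2 * s * (2 * s * A * (1 + A) ^ (2 * s)) * ε ^ (2 * s) * (1 + x) ^ (8 * s + 2) *
        Real.exp (-(c / 2 * x ^ 2)) :=
    mul_le_mul hsecond hw' (Real.exp_pos _).le (by positivity)
  refine (add_le_add hfirst h2).trans (le_of_eq ?_)
  ring

/-- This covers points outside the adapted domain, where the rescaled density is zero and the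
expansion itself is the error. There `ρ ≤ ε x`, so `1 ≤ (ε (1 + x) / ρ) ^ (2s)`: the required power
of `ε` is bought with polynomial growth. -/
theorem exp_mul_abs_expansion_le_of_le {s N : ℕ} {A c ε x ρ T : ℝ} (hA : 0 ≤ A) (hc1 : c ≤ 1)
    (hx : 0 ≤ x) (hρ : 0 < ρ) (hρx : ρ ≤ ε * x) (hT : |T| ≤ A * (1 + x) ^ N) :
    |Real.exp (-(1 / 2 * x ^ 2)) * ∑ t ∈ Finset.range (2 * s), T ^ t / t.factorial| ≤
      (2 * s * (1 + A) ^ (2 * s) / ρ ^ (2 * s)) *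
        ε ^ (2 * s) * (1 + x) ^ (N * (2 * s) + 2 * s) * Real.exp (-(c / 2 * x ^ 2)) := by
  have h1x : 1 ≤ 1 + x := by linarith
  have hw' : Real.exp (-(1 / 2 * x ^ 2)) ≤ Real.exp (-(c / 2 * x ^ 2)) :=
    Real.exp_le_exp.2 (by nlinarith [sq_nonneg x])
  have hsum : |∑ t ∈ Finset.range (2 * s), T ^ t / t.factorial| ≤
      2 * s * ((1 + A) ^ (2 * s) * (1 + x) ^ (N * (2 * s))) := by
    refine (Finset.abs_sum_le_sum_abs _ _).trans ?_
    have hterm : ∀ t ∈ Finset.range (2 * s), |T ^ t / t.factorial| ≤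
        (1 + A) ^ (2 * s) * (1 + x) ^ (N * (2 * s)) := by
      intro t ht
      have ht' := Finset.mem_range.1 ht
      have hfac : (1 : ℝ) ≤ t.factorial := by exact_mod_cast t.factorial_pos
      rw [abs_div, abs_of_pos (by positivity : (0 : ℝ) < t.factorial), abs_pow]
      refine (div_le_self (by positivity) hfac).trans ?_
      have hb : 1 ≤ (1 + A) * (1 + x) ^ N :=
        one_le_mul_of_one_le_of_one_le (by linarith) (one_le_pow₀ h1x)
      calc |T| ^ t ≤ ((1 + A) * (1 + x) ^ N) ^ t := by
            gcongr
            exact hT.trans (by gcongr; linarith)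
        _ ≤ ((1 + A) * (1 + x) ^ N) ^ (2 * s) := pow_le_pow_right₀ hb ht'.le
        _ = _ := by rw [mul_pow, ← pow_mul]
    refine (Finset.sum_le_sum hterm).trans (le_of_eq ?_)
    rw [Finset.sum_const, Finset.card_range, nsmul_eq_mul]
    push_cast
    ring
  have hone : 1 ≤ ε ^ (2 * s) * (1 + x) ^ (2 * s) / ρ ^ (2 * s) := by
    rw [one_le_div (by positivity), ← mul_pow]
    have hε : 0 < ε := by
      by_contra h
      nlinarith
    gcongr
    nlinarith
  rw [abs_mul, abs_of_pos (Real.exp_pos _)]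
  calc Real.exp (-(1 / 2 * x ^ 2)) * |∑ t ∈ Finset.range (2 * s), T ^ t / t.factorial|
      ≤ Real.exp (-(c / 2 * x ^ 2)) *
        (2 * s * ((1 + A) ^ (2 * s) * (1 + x) ^ (N * (2 * s)))) := by gcongr
    _ ≤ Real.exp (-(c / 2 * x ^ 2)) * (2 * s * ((1 + A) ^ (2 * s) * (1 + x) ^ (N * (2 * s)))) *
        (ε ^ (2 * s) * (1 + x) ^ (2 * s) / ρ ^ (2 * s)) :=
          le_mul_of_one_le_right (by positivity) hone
    _ = _ := by rw [pow_add]; ring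

/-! ### Second-order structure of repeatedly differentiable functions -/

/-- The matrix of negated second partial derivatives. -/
def negHessianMatrix {p : ℕ} (f : Param p → ℝ) (x : Param p) : Matrix (Fin p) (Fin p) ℝ :=
  Matrix.of fun i j => -mixedPartial f ![i, j] x

theorem TimesDifferentiableOn.mono {p m m' : ℕ} {f : Param p → ℝ} {U : Set (Param p)}
    (hf : TimesDifferentiableOn m f U) (h : m' ≤ m) : TimesDifferentiableOn m' f U :=
  fun j hj => hf j (hj.trans_le h)

/-- The third derivative makes the second one continuous, which is what symmetry of the Hessian
needs. -/
theorem TimesDifferentiableOn.contDiffOn_two {p m : ℕ} {f : Param p → ℝ} {U : Set (Param p)}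
    (hf : TimesDifferentiableOn m f U) (hm : 3 ≤ m) (hU : IsOpen U) : ContDiffOn ℝ 2 f U := by
  refine contDiffOn_of_differentiableOn (n := 2) fun j hj => ?_
  have hj' : j ≤ 2 := by exact_mod_cast hj
  exact (hf j (by omega)).congr fun x hx => iteratedFDerivWithin_of_isOpen j hU hx

theorem isHermitian_negHessianMatrix {p : ℕ} {f : Param p → ℝ} {U : Set (Param p)}
    (hf : ContDiffOn ℝ 2 f U) (hU : IsOpen U) {x : Param p} (hx : x ∈ U) :
    (negHessianMatrix f x).IsHermitian := by
  have hs : IsSymmSndFDerivAt ℝ f x :=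
    (hf.contDiffAt (hU.mem_nhds hx)).isSymmSndFDerivAt (by simp)
  ext i j
  simp only [negHessianMatrix, Matrix.conjTranspose_apply, Matrix.of_apply, star_trivial,
    mixedPartial, iteratedFDeriv_two_apply]
  congr 1
  exact hs _ _

open Matrix in
theorem iteratedFDeriv_two_diag {p : ℕ} (f : Param p → ℝ) (x v : Param p) :
    iteratedFDeriv ℝ 2 f x (fun _ => v) =
      -((fun i => v i) ⬝ᵥ (negHessianMatrix f x *ᵥ fun i => v i)) := by
  rw [iteratedFDeriv_diag_eq_sum, ← (finTwoArrowEquiv (Fin p)).symm.sum_comp,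
    Fintype.sum_prod_type]
  simp only [dotProduct, mulVec, negHessianMatrix, Finset.mul_sum, ← Finset.sum_neg_distrib,
    finTwoArrowEquiv_symm_apply, Matrix.of_apply, Fin.prod_univ_two, Matrix.cons_val_zero,
    Matrix.cons_val_one]
  refine Finset.sum_congr rfl fun i _ => Finset.sum_congr rfl fun j _ => ?_
  ring

/-- The `j`-th Taylor polynomial component of `z ↦ f (x + L z)` at `0`. -/
def taylorPoly {p : ℕ} (f : Param p → ℝ) (x : Param p) (L : Matrix (Fin p) (Fin p) ℝ) (j : ℕ) :
    MvPolynomial (Fin p) ℝ :=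
  ∑ i : Fin j → Fin p, MvPolynomial.C (mixedPartial f i x / j.factorial) *
    ∏ l, ∑ a, MvPolynomial.C (L (i l) a) * MvPolynomial.X a

theorem isHomogeneous_taylorPoly {p : ℕ} (f : Param p → ℝ) (x : Param p)
    (L : Matrix (Fin p) (Fin p) ℝ) (j : ℕ) : (taylorPoly f x L j).IsHomogeneous j := by
  refine MvPolynomial.IsHomogeneous.sum _ _ _ fun i _ => MvPolynomial.IsHomogeneous.C_mul ?_ _
  have := MvPolynomial.IsHomogeneous.prod (Finset.univ : Finset (Fin j))
    (fun l => ∑ a, MvPolynomial.C (L (i l) a) * MvPolynomial.X a) (fun _ => 1)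
    fun l _ => MvPolynomial.IsHomogeneous.sum _ _ _ fun a _ =>
      MvPolynomial.isHomogeneous_C_mul_X _ _
  simpa using this

theorem eval_taylorPoly {p : ℕ} (f : Param p → ℝ) (x : Param p)
    (L : Matrix (Fin p) (Fin p) ℝ) (j : ℕ) (z : Param p) :
    MvPolynomial.eval (fun i => z i) (taylorPoly f x L j) =
      iteratedFDeriv ℝ j f x (fun _ => matrixMap L z) / j.factorial := by
  rw [iteratedFDeriv_diag_eq_sum, taylorPoly, map_sum, Finset.sum_div]
  refine Finset.sum_congr rfl fun i _ => ?_
  simp only [map_mul, MvPolynomial.eval_C, map_prod, map_sum, MvPolynomial.eval_X,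
    matrixMap_apply, Matrix.mulVec, dotProduct]
  ring

/-! ### The local expansion -/

/-- Deterministic regularity of a log-density `ℓ` on a ball around `θstar` containing its mode
`θhat`. -/
structure LocallyRegular {p : ℕ} (ℓ : Param p → ℝ) (θstar θhat : Param p) (δ B ηlo ηhi : ℝ)
    (m n : ℕ) : Prop where
  timesDifferentiableOn : TimesDifferentiableOn m ℓ (Metric.ball θstar δ)
  abs_mixedPartial_le : ∀ j ≤ m, ∀ i : Fin j → Fin p, ∀ θ ∈ Metric.ball θstar δ,
    |mixedPartial ℓ i θ| ≤ n * B
  spectrum_bounds : ∀ θ ∈ Metric.ball θstar δ, ∀ μ ∈ spectrum ℝ (negHessianMatrix ℓ θ),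
    n * ηlo ≤ μ ∧ μ ≤ n * ηhi
  norm_sub_le : ‖θhat - θstar‖ ≤ δ / 2
  isMaxOn : IsMaxOn ℓ (Metric.ball θstar δ) θhat

/-- The Cholesky factor of the inverse negative Hessian at `θhat`. -/
abbrev scaleMatrix {p : ℕ} (ℓ : Param p → ℝ) (θhat : Param p) : Matrix (Fin p) (Fin p) ℝ :=
  choleskyFactor (negHessianMatrix ℓ θhat)⁻¹

/-- The points which the adapted affine map sends into the ball. -/
def adaptedDomain {p : ℕ} (ℓ : Param p → ℝ) (θstar θhat : Param p) (δ : ℝ) : Set (Param p) :=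
  {z | matrixMap (scaleMatrix ℓ θhat) z + θhat ∈ Metric.ball θstar δ}

/-- The density on the ball, rescaled at its mode. -/
def rescaled {p : ℕ} (ℓ : Param p → ℝ) (θstar θhat : Param p) (δ : ℝ) : Param p → ℝ :=
  (adaptedDomain ℓ θstar θhat δ).indicator fun z =>
    Real.exp (ℓ (matrixMap (scaleMatrix ℓ θhat) z + θhat) - ℓ θhat)

/-- The truncated expansion of `rescaled` relative to the Gaussian weight. -/
def expansion {p : ℕ} (ℓ : Param p → ℝ) (θhat : Param p) (s : ℕ) (z : Param p) : ℝ :=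
  ∑ t ∈ Finset.range (2 * s), (∑ j ∈ Finset.Ico 3 (2 * s + 2),
    MvPolynomial.eval (fun i => z i) (taylorPoly ℓ θhat (scaleMatrix ℓ θhat) j)) ^ t / t.factorial

namespace LocallyRegular

variable {p : ℕ} {ℓ : Param p → ℝ} {θstar θhat : Param p} {δ B ηlo ηhi : ℝ} {m n : ℕ}

theorem mem_ball (h : LocallyRegular ℓ θstar θhat δ B ηlo ηhi m n) (hδ : 0 < δ) :
    θhat ∈ Metric.ball θstar δ := by
  rw [mem_ball_iff_norm]
  linarith [h.norm_sub_le]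

theorem add_mem_ball (h : LocallyRegular ℓ θstar θhat δ B ηlo ηhi m n) {v : Param p}
    (hv : ‖v‖ < δ / 2) : v + θhat ∈ Metric.ball θstar δ := by
  rw [mem_ball_iff_norm, add_sub_assoc]
  linarith [norm_add_le v (θhat - θstar), h.norm_sub_le]

open Matrix in
-- Up to constants `L` contracts lengths by `n^(-1/2)`, and its determinant is at least `(n
-- ηhi)^(-p/2)`.
theorem scale_spec (h : LocallyRegular ℓ θstar θhat δ B ηlo ηhi m n) (hδ : 0 < δ) (hm : 4 ≤ m)
    (hn : 0 < n) (hη : 0 < ηlo) :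
    0 < (scaleMatrix ℓ θhat).det ∧ 1 ≤ (scaleMatrix ℓ θhat).det ^ 2 * (n * ηhi) ^ p ∧
    (∀ z, n * ηlo * ‖matrixMap (scaleMatrix ℓ θhat) z‖ ^ 2 ≤ ‖z‖ ^ 2) ∧
    (∀ z, ‖z‖ ^ 2 ≤ n * ηhi * ‖matrixMap (scaleMatrix ℓ θhat) z‖ ^ 2) ∧
    ∀ z : Param p, (fun i => matrixMap (scaleMatrix ℓ θhat) z i) ⬝ᵥ
      (negHessianMatrix ℓ θhat *ᵥ fun i => matrixMap (scaleMatrix ℓ θhat) z i) = ‖z‖ ^ 2 :=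
  choleskyFactor_inv_spec (isHermitian_negHessianMatrix
      (h.timesDifferentiableOn.contDiffOn_two (by omega) Metric.isOpen_ball)
      Metric.isOpen_ball (h.mem_ball hδ))
    (by positivity : 0 < (n : ℝ) * ηlo) (h.spectrum_bounds θhat (h.mem_ball hδ))

theorem iteratedFDeriv_one_eq_zero (h : LocallyRegular ℓ θstar θhat δ B ηlo ηhi m n) (hδ : 0 < δ)
    (v : Param p) : iteratedFDeriv ℝ 1 ℓ θhat (fun _ => v) = 0 := by
  have hmax : IsLocalMax ℓ θhat :=
    h.isMaxOn.isLocalMax (Metric.isOpen_ball.mem_nhds (h.mem_ball hδ))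
  rw [iteratedFDeriv_one_apply, hmax.fderiv_eq_zero]
  rfl

/-- Quadratic decay of the log-density away from the mode. -/
theorem sub_le (h : LocallyRegular ℓ θstar θhat δ B ηlo ηhi m n) (hδ : 0 < δ) (hm : 4 ≤ m)
    {v : Param p} (hv : v + θhat ∈ Metric.ball θstar δ) :
    ℓ (v + θhat) - ℓ θhat ≤ -(n * ηlo * ‖v‖ ^ 2 / 2) := by
  have hcd := h.timesDifferentiableOn.contDiffOn_two (by omega) Metric.isOpen_ball
  -- The Hessian is controlled on the whole ball, so the quadratic decay holds throughout it and not
  -- only near the mode.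
  have := le_taylor_of_timesDifferentiableOn (N := 2) Metric.isOpen_ball (convex_ball θstar δ)
    (h.timesDifferentiableOn.mono (by omega)) (h.mem_ball hδ) (by rwa [add_comm])
    (K := -(n * ηlo * ‖v‖ ^ 2)) (fun y hy => by
      rw [iteratedFDeriv_two_diag]
      exact neg_le_neg (quadForm_mem_Icc_of_spectrum
        (isHermitian_negHessianMatrix hcd Metric.isOpen_ball hy) (h.spectrum_bounds y hy) v).1)
  rw [Finset.sum_range_succ, Finset.sum_range_one, h.iteratedFDeriv_one_eq_zero hδ,
    iteratedFDeriv_zero_apply, add_comm θhat] at this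
  simp only [Nat.factorial] at this
  norm_num at this
  linarith

theorem norm_scale_le (h : LocallyRegular ℓ θstar θhat δ B ηlo ηhi m n) (hδ : 0 < δ) (hm : 4 ≤ m)
    (hn : 0 < n) (hη : 0 < ηlo) (z : Param p) :
    ‖matrixMap (scaleMatrix ℓ θhat) z‖ ≤ (√ηlo)⁻¹ * (√n)⁻¹ * ‖z‖ := by
  have h1 := (h.scale_spec hδ hm hn hη).2.2.1 z
  have hn' : (0 : ℝ) < n := by exact_mod_cast hn
  have hs : 0 < √ηlo * √n := by positivity
  rw [← mul_inv, inv_mul_eq_div, le_div_iff₀ hs]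
  refine le_of_sq_le_sq ?_ (norm_nonneg _)
  calc (‖matrixMap (scaleMatrix ℓ θhat) z‖ * (√ηlo * √n)) ^ 2
      = (√n) ^ 2 * (√ηlo) ^ 2 * ‖matrixMap (scaleMatrix ℓ θhat) z‖ ^ 2 := by ring
    _ ≤ ‖z‖ ^ 2 := by rwa [Real.sq_sqrt hn'.le, Real.sq_sqrt hη.le]

theorem norm_le_scale (h : LocallyRegular ℓ θstar θhat δ B ηlo ηhi m n) (hδ : 0 < δ) (hm : 4 ≤ m)
    (hn : 0 < n) (hη : 0 < ηlo) (hη' : 0 < ηhi) (z : Param p) :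
    (√n)⁻¹ * ‖z‖ ≤ √ηhi * ‖matrixMap (scaleMatrix ℓ θhat) z‖ := by
  have h1 := (h.scale_spec hδ hm hn hη).2.2.2.1 z
  have hn' : (0 : ℝ) < n := by exact_mod_cast hn
  rw [inv_mul_le_iff₀ (by positivity)]
  refine le_of_sq_le_sq (h1.trans (le_of_eq ?_)) (by positivity)
  rw [mul_pow, mul_pow, Real.sq_sqrt hn'.le, Real.sq_sqrt hη'.le]
  ring

end LocallyRegular

/-- Uniform constant for the scaled derivatives of order at most `N`. -/
def derivConst (p : ℕ) (B ηlo : ℝ) (N : ℕ) : ℝ := B * ((1 + p) * (1 + (√ηlo)⁻¹)) ^ N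

namespace LocallyRegular

variable {p : ℕ} {ℓ : Param p → ℝ} {θstar θhat : Param p} {δ B ηlo ηhi : ℝ} {m n : ℕ}

/-- The scaling behind the whole expansion: a derivative of size `n` meets `j` vectors of length of
order `n^(-1/2) ‖z‖`, and `n * n^(-j/2) = n^(-(j-2)/2)`. -/
theorem abs_iteratedFDeriv_scale_le (h : LocallyRegular ℓ θstar θhat δ B ηlo ηhi m n)
    (hδ : 0 < δ) (hm : 4 ≤ m) (hn : 0 < n) (hη : 0 < ηlo) (hB : 0 ≤ B) {j N : ℕ} (hj2 : 2 ≤ j)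
    (hjm : j ≤ m) (hjN : j ≤ N) {y : Param p} (hy : y ∈ Metric.ball θstar δ) (z : Param p) :
    |iteratedFDeriv ℝ j ℓ y (fun _ => matrixMap (scaleMatrix ℓ θhat) z)| ≤
      derivConst p B ηlo N * (√n)⁻¹ ^ (j - 2) * ‖z‖ ^ j := by
  have hn' : (0 : ℝ) < n := by exact_mod_cast hn
  have hε : (n : ℝ) * (√n)⁻¹ ^ 2 = 1 := by
    rw [inv_pow, Real.sq_sqrt hn'.le, mul_inv_cancel₀ hn'.ne']
  have ha : 0 < (√ηlo)⁻¹ := by positivity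
  -- Adding one to each factor makes the base at least one, so the exponent `N` covers every `j ≤
  -- N`.
  have hp : (p : ℝ) ^ j * (√ηlo)⁻¹ ^ j ≤ ((1 + p) * (1 + (√ηlo)⁻¹)) ^ N := by
    rw [← mul_pow]
    calc ((p : ℝ) * (√ηlo)⁻¹) ^ j ≤ ((1 + p) * (1 + (√ηlo)⁻¹)) ^ j := by
          gcongr <;> linarith
      _ ≤ ((1 + p) * (1 + (√ηlo)⁻¹)) ^ N :=
          pow_le_pow_right₀ (one_le_mul_of_one_le_of_one_le (by simp) (by linarith)) hjN
  calc |iteratedFDeriv ℝ j ℓ y (fun _ => matrixMap (scaleMatrix ℓ θhat) z)|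
      ≤ (p : ℝ) ^ j * (n * B) * ‖matrixMap (scaleMatrix ℓ θhat) z‖ ^ j :=
        abs_iteratedFDeriv_diag_le (fun i => h.abs_mixedPartial_le j hjm i y hy) _
    _ ≤ (p : ℝ) ^ j * (n * B) * ((√ηlo)⁻¹ * (√n)⁻¹ * ‖z‖) ^ j := by
        gcongr
        exact h.norm_scale_le hδ hm hn hη z
    _ = B * ((p : ℝ) ^ j * (√ηlo)⁻¹ ^ j) * (n * (√n)⁻¹ ^ 2) * (√n)⁻¹ ^ (j - 2) * ‖z‖ ^ j := by
        have : (√(n : ℝ))⁻¹ ^ j = (√n)⁻¹ ^ 2 * (√n)⁻¹ ^ (j - 2) := by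
          rw [← pow_add]; congr 1; omega
        rw [mul_pow, mul_pow, this]; ring
    _ ≤ B * ((1 + p) * (1 + (√ηlo)⁻¹)) ^ N * 1 * (√n)⁻¹ ^ (j - 2) * ‖z‖ ^ j := by
        rw [hε]; gcongr
    _ = _ := by rw [derivConst, mul_one]

theorem abs_eval_taylorPoly_le (h : LocallyRegular ℓ θstar θhat δ B ηlo ηhi m n)
    (hδ : 0 < δ) (hm : 4 ≤ m) (hn : 0 < n) (hη : 0 < ηlo) (hB : 0 ≤ B) {j N : ℕ} (hj2 : 2 ≤ j)
    (hjm : j ≤ m) (hjN : j ≤ N) (z : Param p) :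
    |MvPolynomial.eval (fun i => z i) (taylorPoly ℓ θhat (scaleMatrix ℓ θhat) j)| ≤
      derivConst p B ηlo N * (√n)⁻¹ ^ (j - 2) * ‖z‖ ^ j := by
  rw [eval_taylorPoly, abs_div, abs_of_pos (by positivity : (0 : ℝ) < j.factorial)]
  exact (div_le_self (abs_nonneg _) (by exact_mod_cast j.factorial_pos)).trans
    (h.abs_iteratedFDeriv_scale_le hδ hm hn hη hB hj2 hjm hjN (h.mem_ball hδ) z)

/-- Taylor expansion of the log-density in adapted coordinates. -/
theorem abs_sub_taylorPoly_le (h : LocallyRegular ℓ θstar θhat δ B ηlo ηhi m n)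
    (hδ : 0 < δ) (hm : 4 ≤ m) (hn : 0 < n) (hη : 0 < ηlo) (hB : 0 ≤ B) {N N' : ℕ} (hN3 : 3 ≤ N)
    (hNm : N ≤ m) (hNN : N ≤ N') {z : Param p} (hz : z ∈ adaptedDomain ℓ θstar θhat δ) :
    |(ℓ (matrixMap (scaleMatrix ℓ θhat) z + θhat) - ℓ θhat + 1 / 2 * ‖z‖ ^ 2) -
        ∑ j ∈ Finset.Ico 3 N,
          MvPolynomial.eval (fun i => z i) (taylorPoly ℓ θhat (scaleMatrix ℓ θhat) j)| ≤
      derivConst p B ηlo N' * (√n)⁻¹ ^ (N - 2) * ‖z‖ ^ N := by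
  set v := matrixMap (scaleMatrix ℓ θhat) z with hv
  have key := abs_sub_taylor_le Metric.isOpen_ball (convex_ball θstar δ)
    (h.timesDifferentiableOn.mono hNm) (h.mem_ball hδ) (v := v)
    (by rw [add_comm]; exact hz)
    (fun y hy => h.abs_iteratedFDeriv_scale_le hδ hm hn hη hB (by omega) hNm hNN hy z)
  have hnn : 0 ≤ derivConst p B ηlo N' * (√n)⁻¹ ^ (N - 2) * ‖z‖ ^ N := by
    unfold derivConst; positivity
  -- The orders 0, 1, 2 contribute the value at the mode, zero, and exactly `-‖z‖² / 2`.
  have hsum : ∑ j ∈ Finset.range N, iteratedFDeriv ℝ j ℓ θhat (fun _ => v) / j.factorial =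
      ℓ θhat - 1 / 2 * ‖z‖ ^ 2 + ∑ j ∈ Finset.Ico 3 N,
        MvPolynomial.eval (fun i => z i) (taylorPoly ℓ θhat (scaleMatrix ℓ θhat) j) := by
    rw [← Finset.sum_range_add_sum_Ico _ hN3]
    congr 1
    · rw [Finset.sum_range_succ, Finset.sum_range_succ, Finset.sum_range_one,
        h.iteratedFDeriv_one_eq_zero hδ, iteratedFDeriv_zero_apply, iteratedFDeriv_two_diag,
        (h.scale_spec hδ hm hn hη).2.2.2.2 z]
      simp [Nat.factorial]
      ring
    · exact Finset.sum_congr rfl fun j _ => (eval_taylorPoly _ _ _ _ _).symm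
  rw [hsum] at key
  have h2 := key.trans (div_le_self hnn (by exact_mod_cast N.factorial_pos))
  refine le_trans (le_of_eq ?_) h2
  rw [add_comm v]
  congr 1
  ring

/-- The decay `n ηlo ‖L z‖² / 2` meets `‖z‖² ≤ n ηhi ‖L z‖²`. The sample size cancels, leaving a
Gaussian bound uniform in `n`. -/
theorem rescaled_exponent_le (h : LocallyRegular ℓ θstar θhat δ B ηlo ηhi m n)
    (hδ : 0 < δ) (hm : 4 ≤ m) (hn : 0 < n) (hη : 0 < ηlo) (hη' : 0 < ηhi) {z : Param p}
    (hz : z ∈ adaptedDomain ℓ θstar θhat δ) :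
    ℓ (matrixMap (scaleMatrix ℓ θhat) z + θhat) - ℓ θhat ≤ -(ηlo / ηhi / 2 * ‖z‖ ^ 2) := by
  refine (h.sub_le hδ hm hz).trans (neg_le_neg ?_)
  have h1 := (h.scale_spec hδ hm hn hη).2.2.2.1 z
  calc ηlo / ηhi / 2 * ‖z‖ ^ 2
      ≤ ηlo / ηhi / 2 * (n * ηhi * ‖matrixMap (scaleMatrix ℓ θhat) z‖ ^ 2) := by gcongr
    _ = _ := by field_simp

theorem norm_scale_lt_of_mem (h : LocallyRegular ℓ θstar θhat δ B ηlo ηhi m n) {z : Param p}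
    (hz : z ∈ adaptedDomain ℓ θstar θhat δ) :
    ‖matrixMap (scaleMatrix ℓ θhat) z‖ ≤ 2 * δ := by
  have h1 : ‖matrixMap (scaleMatrix ℓ θhat) z + θhat - θstar‖ < δ := mem_ball_iff_norm.1 hz
  have h2 := h.norm_sub_le
  have h3 := _root_.norm_sub_le (matrixMap (scaleMatrix ℓ θhat) z + θhat - θstar) (θhat - θstar)
  have h4 : matrixMap (scaleMatrix ℓ θhat) z + θhat - θstar - (θhat - θstar) =
    matrixMap (scaleMatrix ℓ θhat) z := by abel
  rw [h4] at h3
  linarith [norm_nonneg (θhat - θstar)]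

theorem mem_adaptedDomain (h : LocallyRegular ℓ θstar θhat δ B ηlo ηhi m n)
    (hδ : 0 < δ) (hm : 4 ≤ m) (hn : 0 < n) (hη : 0 < ηlo) {z : Param p}
    (hz : (√ηlo)⁻¹ * (√n)⁻¹ * ‖z‖ < δ / 2) : z ∈ adaptedDomain ℓ θstar θhat δ :=
  h.add_mem_ball ((h.norm_scale_le hδ hm hn hη z).trans_lt hz)

end LocallyRegular

theorem inv_sqrt_natCast_le_one {n : ℕ} (hn : 0 < n) : (√(n : ℝ))⁻¹ ≤ 1 :=
  inv_le_one_of_one_le₀ (Real.one_le_sqrt.2 (by exact_mod_cast hn))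

/-- Uniform pointwise comparison of the rescaled density with its truncated expansion. -/
theorem exists_abs_rescaled_sub_le {p : ℕ} {δ B ηlo ηhi : ℝ} {m s : ℕ} (hδ : 0 < δ) (hm : 4 ≤ m)
    (hsm : 2 * s + 2 ≤ m) (hs : 1 ≤ s) (hη : 0 < ηlo) (hηη : ηlo ≤ ηhi) (hB : 0 ≤ B) :
    ∃ C : ℝ, 0 ≤ C ∧ ∀ (ℓ : Param p → ℝ) (θstar θhat : Param p) (n : ℕ), 0 < n →
      LocallyRegular ℓ θstar θhat δ B ηlo ηhi m n → ∀ z : Param p,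
      |rescaled ℓ θstar θhat δ z - gaussWeight z * expansion ℓ θhat s z| ≤
        C * (√n)⁻¹ ^ (2 * s) * ((1 + ‖z‖) ^ ((2 * s + 2) * (2 * s) + 8 * s + 2) *
          Real.exp (-(ηlo / ηhi / 2 * ‖z‖ ^ 2))) := by
  have hη' : 0 < ηhi := hη.trans_le hηη
  set A₀ := derivConst p B ηlo (2 * s + 2) with hA₀
  have hA₀nn : 0 ≤ A₀ := by rw [hA₀]; unfold derivConst; positivity
  -- Bound for `ε ‖z‖` on the adapted domain, where `‖L z‖ ≤ 2δ`.
  set q := √ηhi * (2 * δ) with hq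
  have hq0 : 0 ≤ q := by positivity
  -- The first summand serves the exact exponent `f`, the second the sum `T` of at most `2s + 2`
  -- Taylor terms.
  set A := A₀ + (2 * s + 2) * (A₀ * (1 + q) ^ (2 * s + 2)) with hA
  have hAnn : 0 ≤ A := by positivity
  have hA₀A : A₀ ≤ A := by
    rw [hA]
    have : 0 ≤ (2 * s + 2) * (A₀ * (1 + q) ^ (2 * s + 2)) := by positivity
    linarith
  -- Threshold such that `ε ‖z‖ < ρ` forces `z` into the adapted domain.
  set ρ := δ / 2 * √ηlo with hρdef
  have hρ : 0 < ρ := by positivity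
  set c := ηlo / ηhi with hc
  have hc1 : c ≤ 1 := (div_le_one hη').2 hηη
  set C₁ : ℝ := (2 * s + 3) * A ^ (2 * s) + 2 * s * (2 * s * A * (1 + A) ^ (2 * s)) with hC₁
  set C₂ : ℝ := 2 * s * (1 + A) ^ (2 * s) / ρ ^ (2 * s) with hC₂
  have hC₁0 : 0 ≤ C₁ := by positivity
  have hC₂0 : 0 ≤ C₂ := by positivity
  refine ⟨C₁ + C₂, by positivity, fun ℓ θstar θhat n hn h z => ?_⟩
  have hε0 : 0 ≤ (√(n : ℝ))⁻¹ := by positivity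
  have hε1 := inv_sqrt_natCast_le_one hn
  set ε := (√(n : ℝ))⁻¹ with hε
  have h1x : 1 ≤ 1 + ‖z‖ := by linarith [norm_nonneg z]
  have hT : ∀ j ∈ Finset.Ico 3 (2 * s + 2),
      |MvPolynomial.eval (fun i => z i) (taylorPoly ℓ θhat (scaleMatrix ℓ θhat) j)| ≤
        A₀ * ε ^ (j - 2) * ‖z‖ ^ j := fun j hj => by
    have := Finset.mem_Ico.1 hj
    exact h.abs_eval_taylorPoly_le hδ hm hn hη hB (by omega) (by omega) (by omega) z
  set T := ∑ j ∈ Finset.Ico 3 (2 * s + 2),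
    MvPolynomial.eval (fun i => z i) (taylorPoly ℓ θhat (scaleMatrix ℓ θhat) j) with hTdef
  have hTsum : ∀ X : ℝ, 0 ≤ X →
      (∀ j ∈ Finset.Ico 3 (2 * s + 2), ε ^ (j - 2) * ‖z‖ ^ j ≤ X) →
      |T| ≤ (2 * s + 2) * (A₀ * X) := by
    intro X hX hjX
    refine (Finset.abs_sum_le_sum_abs _ _).trans ((Finset.sum_le_sum fun j hj => ?_ :
      _ ≤ ∑ _j ∈ Finset.Ico 3 (2 * s + 2), A₀ * X).trans ?_)
    · refine (hT j hj).trans ?_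
      rw [mul_assoc]
      exact mul_le_mul_of_nonneg_left (hjX j hj) hA₀nn
    · rw [Finset.sum_const, nsmul_eq_mul]
      refine mul_le_mul_of_nonneg_right ?_ (by positivity)
      rw [Nat.card_Ico]
      exact_mod_cast (by omega : 2 * s + 2 - 3 ≤ 2 * s + 2)
  have hexp : expansion ℓ θhat s z = ∑ t ∈ Finset.range (2 * s), T ^ t / t.factorial := rfl
  by_cases hz : z ∈ adaptedDomain ℓ θstar θhat δ
  · have hεz : ε * ‖z‖ ≤ q := (h.norm_le_scale hδ hm hn hη hη' z).trans (by
      rw [hq]; gcongr; exact h.norm_scale_lt_of_mem hz)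
    have hTle : |T| ≤ A * ε * ‖z‖ ^ 3 := by
      have := hTsum ((1 + q) ^ (2 * s + 2) * (ε * ‖z‖ ^ 3)) (by positivity) fun j hj => by
        have hj' := Finset.mem_Ico.1 hj
        -- The surplus factor `(ε ‖z‖) ^ (j - 3)` is bounded on the adapted domain, so every term is
        -- cubic with one factor `ε`.
        calc ε ^ (j - 2) * ‖z‖ ^ j = (ε * ‖z‖) ^ (j - 3) * (ε * ‖z‖ ^ 3) := by
              have h1 : ε ^ (j - 2) = ε ^ (j - 3) * ε := by rw [← pow_succ]; congr 1; omega
              have h2 : ‖z‖ ^ j = ‖z‖ ^ (j - 3) * ‖z‖ ^ 3 := by rw [← pow_add]; congr 1; omega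
              rw [h1, h2]; ring
          _ ≤ (1 + q) ^ (2 * s + 2) * (ε * ‖z‖ ^ 3) := by
              gcongr
              exact (pow_le_pow_left₀ (by positivity) (by linarith) _).trans
                (pow_le_pow_right₀ (by linarith) (by omega))
      refine this.trans ?_
      rw [hA]
      have : 0 ≤ A₀ * (ε * ‖z‖ ^ 3) := by positivity
      linarith
    set f := ℓ (matrixMap (scaleMatrix ℓ θhat) z + θhat) - ℓ θhat + 1 / 2 * ‖z‖ ^ 2 with hf
    have hfT : |f - T| ≤ A * ε ^ (2 * s) * ‖z‖ ^ (2 * s + 2) := by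
      refine (h.abs_sub_taylorPoly_le hδ hm hn hη hB (by omega) hsm le_rfl hz).trans ?_
      simp only [Nat.add_sub_cancel]
      gcongr
    have hfle : |f| ≤ A * ε * ‖z‖ ^ 3 := by
      have := h.abs_sub_taylorPoly_le hδ hm hn hη hB (N := 3) (N' := 2 * s + 2) le_rfl (by omega)
        (by omega) hz
      simp only [Finset.Ico_self, Finset.sum_empty, sub_zero] at this
      refine this.trans ?_
      norm_num
      gcongr
    have hfc : f ≤ (1 - c) / 2 * ‖z‖ ^ 2 := by
      have := h.rescaled_exponent_le hδ hm hn hη hη' hz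
      rw [hf]
      linarith
    have key := abs_exp_sub_expansion_le hAnn hc1 hε0 hε1 (norm_nonneg z) hfT hfle hTle hfc
    have hres : rescaled ℓ θstar θhat δ z = Real.exp (f - 1 / 2 * ‖z‖ ^ 2) := by
      rw [rescaled, Set.indicator_of_mem hz, hf]
      congr 1
      ring
    rw [hres, hexp, gaussWeight]
    refine key.trans ?_
    rw [← hC₁]
    calc C₁ * ε ^ (2 * s) * (1 + ‖z‖) ^ (8 * s + 2) * Real.exp (-(c / 2 * ‖z‖ ^ 2))
        ≤ (C₁ + C₂) * ε ^ (2 * s) * (1 + ‖z‖) ^ ((2 * s + 2) * (2 * s) + 8 * s + 2) *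
          Real.exp (-(c / 2 * ‖z‖ ^ 2)) := by
          have : C₁ ≤ C₁ + C₂ := by linarith
          have hpow : (1 + ‖z‖) ^ (8 * s + 2) ≤
              (1 + ‖z‖) ^ ((2 * s + 2) * (2 * s) + 8 * s + 2) :=
            pow_le_pow_right₀ h1x (by linarith [Nat.zero_le ((2 * s + 2) * (2 * s))])
          exact mul_le_mul_of_nonneg_right (mul_le_mul (by gcongr) hpow (by positivity)
            (by positivity)) (Real.exp_pos _).le
      _ = _ := by ring
  · have hρz : ρ ≤ ε * ‖z‖ := by
      by_contra hlt
      refine hz (h.mem_adaptedDomain hδ hm hn hη ?_)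
      push Not at hlt
      rw [mul_assoc, inv_mul_lt_iff₀ (by positivity), mul_comm (√ηlo)]
      exact hlt
    have hTle : |T| ≤ A * (1 + ‖z‖) ^ (2 * s + 2) := by
      have := hTsum ((1 + ‖z‖) ^ (2 * s + 2)) (by positivity) fun j hj => by
        have hj' := Finset.mem_Ico.1 hj
        calc ε ^ (j - 2) * ‖z‖ ^ j ≤ 1 * (1 + ‖z‖) ^ (2 * s + 2) := by
              gcongr
              · exact pow_le_one₀ hε0 hε1
              · exact (pow_le_pow_left₀ (norm_nonneg _) (by linarith) _).trans
                  (pow_le_pow_right₀ h1x (by omega))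
          _ = _ := one_mul _
      refine this.trans ?_
      rw [← mul_assoc]
      gcongr
      rw [hA]
      have h1 : A₀ ≤ A₀ * (1 + q) ^ (2 * s + 2) :=
        le_mul_of_one_le_right hA₀nn (one_le_pow₀ (by linarith))
      have h2 : (2 * s + 2) * A₀ ≤ (2 * s + 2) * (A₀ * (1 + q) ^ (2 * s + 2)) := by gcongr
      linarith
    have key := exp_mul_abs_expansion_le_of_le (s := s) hAnn hc1 (norm_nonneg z) hρ hρz hTle
    rw [rescaled, Set.indicator_of_notMem hz, zero_sub, abs_neg, hexp, gaussWeight]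
    refine key.trans ?_
    rw [← hC₂]
    calc C₂ * ε ^ (2 * s) * (1 + ‖z‖) ^ ((2 * s + 2) * (2 * s) + 2 * s) *
          Real.exp (-(c / 2 * ‖z‖ ^ 2))
        ≤ (C₁ + C₂) * ε ^ (2 * s) * (1 + ‖z‖) ^ ((2 * s + 2) * (2 * s) + 8 * s + 2) *
          Real.exp (-(c / 2 * ‖z‖ ^ 2)) := by
          have : C₂ ≤ C₁ + C₂ := by linarith
          have hpow : (1 + ‖z‖) ^ ((2 * s + 2) * (2 * s) + 2 * s) ≤
              (1 + ‖z‖) ^ ((2 * s + 2) * (2 * s) + 8 * s + 2) :=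
            pow_le_pow_right₀ h1x (by linarith)
          exact mul_le_mul_of_nonneg_right (mul_le_mul (by gcongr) hpow (by positivity)
            (by positivity)) (Real.exp_pos _).le
      _ = _ := by ring

section Rescaled

variable {p : ℕ} {ℓ : Param p → ℝ} {θstar θhat : Param p} {δ B ηlo ηhi : ℝ} {m n : ℕ}

theorem isOpen_adaptedDomain : IsOpen (adaptedDomain ℓ θstar θhat δ) :=
  Metric.isOpen_ball.preimage (by fun_prop)

theorem rescaled_nonneg (z : Param p) : 0 ≤ rescaled ℓ θstar θhat δ z :=
  Set.indicator_nonneg (fun _ _ => (Real.exp_pos _).le) z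

theorem LocallyRegular.aestronglyMeasurable_rescaled
    (h : LocallyRegular ℓ θstar θhat δ B ηlo ηhi m n) (hm : 4 ≤ m) :
    AEStronglyMeasurable (rescaled ℓ θstar θhat δ) := by
  have hc : ContinuousOn ℓ (Metric.ball θstar δ) :=
    (h.timesDifferentiableOn.contDiffOn_two (by omega) Metric.isOpen_ball).continuousOn
  have hc' : ContinuousOn (fun z => Real.exp (ℓ (matrixMap (scaleMatrix ℓ θhat) z + θhat) - ℓ θhat))
      (adaptedDomain ℓ θstar θhat δ) := by
    refine Real.continuous_exp.comp_continuousOn (ContinuousOn.sub ?_ continuousOn_const)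
    exact hc.comp (by fun_prop) fun z hz => hz
  exact (aestronglyMeasurable_indicator_iff isOpen_adaptedDomain.measurableSet).2
    (hc'.aestronglyMeasurable isOpen_adaptedDomain.measurableSet)

theorem LocallyRegular.integrable_rescaled
    (h : LocallyRegular ℓ θstar θhat δ B ηlo ηhi m n) (hδ : 0 < δ) (hm : 4 ≤ m)
    (hn : 0 < n) (hη : 0 < ηlo) (hη' : 0 < ηhi) : Integrable (rescaled ℓ θstar θhat δ) := by
  have hint := integrable_one_add_norm_pow_mul_exp (p := p)
    (by positivity : 0 < ηlo / ηhi / 2) 0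
  refine hint.mono' (h.aestronglyMeasurable_rescaled hm) (Eventually.of_forall fun z => ?_)
  rw [Real.norm_of_nonneg (rescaled_nonneg z), pow_zero, one_mul, rescaled]
  by_cases hz : z ∈ adaptedDomain ℓ θstar θhat δ
  · rw [Set.indicator_of_mem hz]
    exact Real.exp_le_exp.2 (h.rescaled_exponent_le hδ hm hn hη hη' hz)
  · rw [Set.indicator_of_notMem hz]
    exact (Real.exp_pos _).le

theorem continuous_expansion (s : ℕ) : Continuous (expansion ℓ θhat s) := by
  unfold expansion
  refine continuous_finsetSum _ fun t _ => Continuous.div_const (Continuous.pow ?_ _) _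
  exact continuous_finsetSum _ fun j _ => continuous_eval_coords _

end Rescaled

/-- In adapted coordinates the local integral has a uniform lower bound, and the quadrature rule
approximates it with error `O(n^{-⌊(k+2)/3⌋})`. -/
theorem exists_rescaled_quadrature_bound {p k : ℕ} {R : QuadRule p} (hsymm : R.IsSymmetric)
    (hexact : R.IsExact k) (hk : 1 ≤ k) {δ B ηlo ηhi : ℝ} {m : ℕ} (hδ : 0 < δ) (hm : 4 ≤ m)
    (hkm : k ≤ m / 2) (hη : 0 < ηlo) (hηη : ηlo ≤ ηhi) (hB : 0 ≤ B) :
    ∃ C c : ℝ, 0 ≤ C ∧ 0 < c ∧ ∃ n₀ : ℕ, 0 < n₀ ∧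
      ∀ (ℓ : Param p → ℝ) (θstar θhat : Param p) (n : ℕ), n₀ ≤ n →
      LocallyRegular ℓ θstar θhat δ B ηlo ηhi m n →
      (∀ z ∈ R.points, z ∈ adaptedDomain ℓ θstar θhat δ) ∧
      c ≤ ∫ z, rescaled ℓ θstar θhat δ z ∧
      |(∑ z ∈ R.points, rescaled ℓ θstar θhat δ z * R.weight z) -
        ∫ z, rescaled ℓ θstar θhat δ z| ≤ C / (n : ℝ) ^ ((k + 2) / 3) := by
  set s := (k + 2) / 3 with hs
  have hη' : 0 < ηhi := hη.trans_le hηη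
  obtain ⟨C₁, hC₁, hpt⟩ := exists_abs_rescaled_sub_le (p := p) (s := s) hδ hm (by omega) (by omega)
    hη hηη hB
  obtain ⟨C₂, hC₂, hexpn⟩ := QuadRule.abs_error_expansion_le hsymm hexact (2 * s + 2) (2 * s)
    (A := derivConst p B ηlo (2 * s + 2)) (by unfold derivConst; positivity)
  set W : Param p → ℝ := fun z => (1 + ‖z‖) ^ ((2 * s + 2) * (2 * s) + 8 * s + 2) *
    Real.exp (-(ηlo / ηhi / 2 * ‖z‖ ^ 2)) with hW
  have hWint : Integrable W := integrable_one_add_norm_pow_mul_exp (by positivity) _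
  have hW0 : ∀ z, 0 ≤ W z := fun z => by positivity
  obtain ⟨Z, hZ⟩ : ∃ Z : ℝ, ∀ z ∈ R.points, ‖z‖ ≤ Z :=
    ⟨∑ z ∈ R.points, ‖z‖, fun z hz =>
      Finset.single_le_sum (f := fun z => ‖z‖) (fun _ _ => norm_nonneg _) hz⟩
  set Z' := max Z 1 with hZ'
  have hZ'0 : 0 < Z' := zero_lt_one.trans_le (le_max_right _ _)
  -- From this sample size on, the ball of radius `Z'`, which contains all nodes and the unit ball,
  -- lies in the adapted domain.
  obtain ⟨n₁, hn₁⟩ := exists_nat_gt (((√ηlo)⁻¹ * Z' / (δ / 2)) ^ 2)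
  set A₀ := derivConst p B ηlo 3 with hA₀
  have hA₀nn : 0 ≤ A₀ := by rw [hA₀]; unfold derivConst; positivity
  -- In the upper constant, `C₁` pays for replacing `F` by its expansion in the integral and in the
  -- sum, and `C₂` for the rule's error on the expansion. The lower constant uses only the unit
  -- ball, where the third-order Taylor bound keeps the exponent above `-1/2 - A₀`.
  refine ⟨C₁ * ((∫ z, W z) + ∑ z ∈ R.points, W z * |R.weight z|) + C₂,
    Real.exp (-(1 / 2) - A₀) * volume.real (Metric.closedBall (0 : Param p) 1), ?_, ?_,
    n₁ + 1, by omega, ?_⟩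
  · have h1 : 0 ≤ ∫ z, W z := integral_nonneg hW0
    have h2 : 0 ≤ ∑ z ∈ R.points, W z * |R.weight z| :=
      Finset.sum_nonneg fun z _ => mul_nonneg (hW0 z) (abs_nonneg _)
    positivity
  · refine mul_pos (Real.exp_pos _) ?_
    rw [measureReal_def, ENNReal.toReal_pos_iff]
    exact ⟨Metric.measure_closedBall_pos _ _ one_pos, measure_closedBall_lt_top⟩
  intro ℓ θstar θhat n hn h
  have hn0 : 0 < n := by omega
  have hn' : (0 : ℝ) < n := by exact_mod_cast hn0
  have hε0 : 0 ≤ (√(n : ℝ))⁻¹ := by positivity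
  have hε1 := inv_sqrt_natCast_le_one hn0
  have hdom : ∀ z : Param p, ‖z‖ ≤ Z' → z ∈ adaptedDomain ℓ θstar θhat δ := by
    intro z hz
    refine h.mem_adaptedDomain hδ hm hn0 hη ?_
    have h1 : (√ηlo)⁻¹ * Z' / (δ / 2) < √n := by
      refine Real.lt_sqrt_of_sq_lt (hn₁.trans ?_)
      exact_mod_cast (by omega : n₁ < n)
    rw [div_lt_iff₀ (by positivity)] at h1
    calc (√ηlo)⁻¹ * (√n)⁻¹ * ‖z‖ ≤ (√ηlo)⁻¹ * (√n)⁻¹ * Z' := by gcongr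
      _ = (√ηlo)⁻¹ * Z' / √n := by rw [div_eq_mul_inv]; ring
      _ < δ / 2 := by rw [div_lt_iff₀ (by positivity)]; linarith
  have hFint := h.integrable_rescaled hδ hm hn0 hη hη'
  set F := rescaled ℓ θstar θhat δ with hF
  refine ⟨fun z hz => hdom z ((hZ z hz).trans (le_max_left _ _)), ?_, ?_⟩
  · have hlow : ∀ z ∈ Metric.closedBall (0 : Param p) 1, Real.exp (-(1 / 2) - A₀) ≤ F z := by
      intro z hz
      have hz1 : ‖z‖ ≤ 1 := mem_closedBall_zero_iff.1 hz
      have hzD := hdom z (hz1.trans (le_max_right _ _))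
      rw [hF, rescaled, Set.indicator_of_mem hzD]
      refine Real.exp_le_exp.2 ?_
      have := h.abs_sub_taylorPoly_le hδ hm hn0 hη hB (N := 3) (N' := 3) le_rfl (by omega)
        le_rfl hzD
      simp only [Finset.Ico_self, Finset.sum_empty, sub_zero] at this
      have h2 := (abs_le.1 this).1
      have h3 : A₀ * (√(n : ℝ))⁻¹ ^ (3 - 2) * ‖z‖ ^ 3 ≤ A₀ * 1 * 1 := by
        gcongr
        · exact pow_le_one₀ hε0 hε1
        · exact pow_le_one₀ (norm_nonneg _) hz1
      have h4 : ‖z‖ ^ 2 ≤ 1 := pow_le_one₀ (norm_nonneg _) hz1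
      linarith
    calc Real.exp (-(1 / 2) - A₀) * volume.real (Metric.closedBall (0 : Param p) 1)
        = ∫ _z in Metric.closedBall (0 : Param p) 1, Real.exp (-(1 / 2) - A₀) := by
          rw [setIntegral_const, smul_eq_mul, mul_comm]
      _ ≤ ∫ z in Metric.closedBall (0 : Param p) 1, F z :=
          setIntegral_mono_on (integrableOn_const measure_closedBall_lt_top.ne)
            hFint.integrableOn measurableSet_closedBall hlow
      _ ≤ ∫ z, F z := setIntegral_le_integral hFint (Eventually.of_forall rescaled_nonneg)
  · set G : Param p → ℝ := fun z => gaussWeight z * expansion ℓ θhat s z with hG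
    have hd : ∀ z, |F z - G z| ≤ C₁ * (√n)⁻¹ ^ (2 * s) * W z := hpt ℓ θstar θhat n hn0 h
    have hGc : Continuous G := continuous_gaussWeight.mul (continuous_expansion s)
    have hdint : Integrable fun z => F z - G z :=
      (hWint.const_mul (C₁ * (√n)⁻¹ ^ (2 * s))).mono'
        (hFint.aestronglyMeasurable.sub hGc.aestronglyMeasurable) (Eventually.of_forall hd)
    have hGint : Integrable G := by
      have := hFint.sub hdint
      refine this.congr (Eventually.of_forall fun z => ?_)
      simp
    have herr := hexpn (taylorPoly ℓ θhat (scaleMatrix ℓ θhat)) (√n)⁻¹ hε0 hε1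
      (fun j _ => isHomogeneous_taylorPoly _ _ _ j)
      (fun j hj z => by
        have := Finset.mem_Ico.1 hj
        exact h.abs_eval_taylorPoly_le hδ hm hn0 hη hB (by omega) (by omega) (by omega) z)
    have h1 : |∫ z, (F z - G z)| ≤ C₁ * (√n)⁻¹ ^ (2 * s) * ∫ z, W z := by
      rw [← integral_const_mul, ← Real.norm_eq_abs]
      exact norm_integral_le_of_norm_le (hWint.const_mul _) (Eventually.of_forall hd)
    have h2 : |∑ z ∈ R.points, (F z - G z) * R.weight z| ≤
        C₁ * (√n)⁻¹ ^ (2 * s) * ∑ z ∈ R.points, W z * |R.weight z| := by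
      rw [Finset.mul_sum]
      refine (Finset.abs_sum_le_sum_abs _ _).trans (Finset.sum_le_sum fun z _ => ?_)
      rw [abs_mul, ← mul_assoc]
      exact mul_le_mul_of_nonneg_right (hd z) (abs_nonneg _)
    have h3 : |(∫ z, G z) - ∑ z ∈ R.points, G z * R.weight z| ≤ C₂ * (√n)⁻¹ ^ (2 * s) := herr
    have hsplit : (∑ z ∈ R.points, F z * R.weight z) - ∫ z, F z =
        (∑ z ∈ R.points, (F z - G z) * R.weight z) - (∫ z, (F z - G z)) -
          ((∫ z, G z) - ∑ z ∈ R.points, G z * R.weight z) := by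
      rw [integral_sub hFint hGint]
      simp_rw [sub_mul]
      rw [Finset.sum_sub_distrib]
      ring
    have hεn : (√(n : ℝ))⁻¹ ^ (2 * s) = 1 / (n : ℝ) ^ s := by
      rw [pow_mul, inv_pow, Real.sq_sqrt hn'.le, inv_pow, one_div]
    rw [hεn] at h1 h2 h3
    rw [hsplit]
    refine (abs_sub _ _).trans ((add_le_add (abs_sub _ _) le_rfl).trans ?_)
    refine (add_le_add (add_le_add h2 h1) h3).trans (le_of_eq ?_)
    ring

/-! ### From the local expansion to the posterior -/

theorem matrixMap_bijective {p : ℕ} {L : Matrix (Fin p) (Fin p) ℝ} (hL : L.det ≠ 0) :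
    Function.Bijective (matrixMap L) := by
  have hinj : Function.Injective (matrixMap L) := by
    intro x y hxy
    have h1 : L.mulVec (fun i => x i) = L.mulVec (fun i => y i) := by
      simpa [matrixMap_apply] using hxy
    have h2 := Matrix.mulVec_injective_of_isUnit
      ((Matrix.isUnit_iff_isUnit_det L).2 (isUnit_iff_ne_zero.2 hL)) h1
    ext i
    exact congrFun h2 i
  exact ⟨hinj, (LinearMap.injective_iff_surjective (f := (matrixMap L).toLinearMap)).1 hinj⟩

theorem setIntegral_ball_eq {p : ℕ} {u : Param p → ℝ} {θstar θhat : Param p} {δ : ℝ}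
    {L : Matrix (Fin p) (Fin p) ℝ} (hL : 0 < L.det) :
    ∫ θ in Metric.ball θstar δ, u θ =
      L.det * ∫ z in {z | matrixMap L z + θhat ∈ Metric.ball θstar δ},
        u (matrixMap L z + θhat) := by
  set D : Set (Param p) := {z | matrixMap L z + θhat ∈ Metric.ball θstar δ} with hD
  have hDmeas : MeasurableSet D :=
    measurableSet_ball.preimage (by fun_prop : Measurable fun z => matrixMap L z + θhat)
  have hbij := matrixMap_bijective hL.ne'
  have himg : (fun z => matrixMap L z + θhat) '' D = Metric.ball θstar δ := by
    refine Set.image_preimage_eq _ fun y => ?_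
    obtain ⟨x, hx⟩ := hbij.2 (y - θhat)
    exact ⟨x, by simp [hx]⟩
  have key := integral_image_eq_integral_abs_det_fderiv_smul volume hDmeas
    (f := fun z => matrixMap L z + θhat) (f' := fun _ => matrixMap L)
    (fun z _ => ((matrixMap L).hasFDerivAt.add_const θhat).hasFDerivWithinAt)
    (fun x _ y _ hxy => hbij.1 (add_right_cancel hxy)) u
  rw [himg] at key
  rw [key, det_matrixMap, abs_of_pos hL]
  simp only [smul_eq_mul]
  rw [integral_const_mul]

/-- Of the `p + s` powers of `n` gained from the exponential series, `p` compensate for the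
determinant of the scale matrix and `s` give the rate. -/
theorem exp_neg_mul_mul_pow_le {b η : ℝ} (hb : 0 < b) (hη : 0 < η) (p s : ℕ) {n : ℕ} (hn : 0 < n) :
    Real.exp (-(n * b)) * (1 + n * η) ^ p ≤
      ((p + s).factorial * (1 + η) ^ p / b ^ (p + s)) / (n : ℝ) ^ s := by
  have hn' : (1 : ℝ) ≤ n := by exact_mod_cast hn
  have h1 : ((n : ℝ) * b) ^ (p + s) ≤ (p + s).factorial * Real.exp (n * b) := by
    have := Real.pow_div_factorial_le_exp ((n : ℝ) * b) (by positivity) (p + s)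
    rwa [div_le_iff₀' (by positivity)] at this
  have h2 : (1 + n * η) ^ p ≤ ((n : ℝ) * (1 + η)) ^ p := by
    gcongr
    linarith
  rw [div_div, le_div_iff₀ (by positivity), Real.exp_neg]
  have h3 : ((n : ℝ) * b) ^ (p + s) * (Real.exp (n * b))⁻¹ ≤ (p + s).factorial := by
    rwa [← div_eq_mul_inv, div_le_iff₀ (Real.exp_pos _)]
  calc (Real.exp (n * b))⁻¹ * (1 + n * η) ^ p * (b ^ (p + s) * (n : ℝ) ^ s)
      ≤ (Real.exp (n * b))⁻¹ * ((n : ℝ) * (1 + η)) ^ p * (b ^ (p + s) * (n : ℝ) ^ s) := by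
        gcongr
    _ = ((n : ℝ) * b) ^ (p + s) * (Real.exp (n * b))⁻¹ * (1 + η) ^ p := by
        rw [mul_pow, mul_pow, pow_add (n : ℝ)]; ring
    _ ≤ _ := by gcongr

namespace BayesModel

variable {p d : ℕ} (M : BayesModel p d)

/-- A non-integrable function has integral `0` by convention, so the value `1` forces integrability.
-/
theorem integrableOn_prior : IntegrableOn M.prior M.space := by
  by_contra h
  have := integral_undef (μ := volume.restrict M.space) h
  rw [M.integral_prior] at this
  exact one_ne_zero this

theorem unnormPost_nonneg (n : ℕ) (Y : Dataset d n) {θ : Param p} (hθ : θ ∈ M.space) :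
    0 ≤ M.unnormPost n Y θ :=
  mul_nonneg (M.prior_nonneg θ hθ) (M.lik_nonneg n Y θ hθ)

theorem aestronglyMeasurable_unnormPost (n : ℕ) (Y : Dataset d n) :
    AEStronglyMeasurable (M.unnormPost n Y) (volume.restrict M.space) :=
  M.integrableOn_prior.aestronglyMeasurable.mul (M.aemeasurable_lik n Y).aestronglyMeasurable

/-- The regularity conditions on one dataset that yield the error bounds. -/
structure RegularDataset (n : ℕ) (Y : Dataset d n) (θstar θhat : Param p)
    (δ B ηlo ηhi b c₁ : ℝ) (m : ℕ) : Prop where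
  locallyRegular : LocallyRegular (M.logPost n Y) θstar θhat δ B ηlo ηhi m n
  unnormPost_pos : ∀ θ ∈ Metric.ball θstar δ, 0 < M.unnormPost n Y θ
  ball_subset : Metric.ball θstar δ ⊆ M.space
  separation : ∀ θ ∈ M.space \ Metric.ball θstar δ, 0 < M.lik n Y θ →
      M.logLik n Y θ - M.logLik n Y θstar ≤ -(n * b)
  isPosteriorMode : M.IsPosteriorMode n Y θhat
  le_prior : c₁ ≤ M.prior θstar

namespace RegularDataset

variable {M} {n : ℕ} {Y : Dataset d n} {θstar θhat : Param p} {δ B ηlo ηhi b c₁ : ℝ} {m : ℕ}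

/-- Separation compares likelihoods only, so the prior is kept as the integrable majorant. The
likelihood at `θstar` is at most the posterior maximum divided by `c₁`, since the prior there is at
least `c₁`. -/
theorem unnormPost_le_off_ball (h : M.RegularDataset n Y θstar θhat δ B ηlo ηhi b c₁ m)
    (hδ : 0 < δ) (hc₁ : 0 < c₁) {θ : Param p} (hθ : θ ∈ M.space \ Metric.ball θstar δ) :
    M.unnormPost n Y θ ≤ M.prior θ * (M.unnormPost n Y θhat / c₁ * Real.exp (-(n * b))) := by
  have hstar : θstar ∈ Metric.ball θstar δ := Metric.mem_ball_self hδ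
  have hstarS := h.ball_subset hstar
  have hpr := M.prior_nonneg θ hθ.1
  have hpos := h.unnormPost_pos θstar hstar
  have hprs : 0 < M.prior θstar := hc₁.trans_le h.le_prior
  have hlik : 0 < M.lik n Y θstar := by
    rw [unnormPost] at hpos
    exact (pos_iff_pos_of_mul_pos hpos).1 hprs
  have hle : M.lik n Y θstar ≤ M.unnormPost n Y θhat / c₁ := by
    rw [le_div_iff₀ hc₁]
    calc M.lik n Y θstar * c₁ ≤ M.lik n Y θstar * M.prior θstar :=
          mul_le_mul_of_nonneg_left h.le_prior hlik.le
      _ = M.unnormPost n Y θstar := mul_comm _ _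
      _ ≤ _ := h.isPosteriorMode.2 hstarS
  have hu := M.unnormPost_nonneg n Y h.isPosteriorMode.1
  refine mul_le_mul_of_nonneg_left ?_ hpr
  -- Separation says nothing where the likelihood vanishes, but there the bound is trivial.
  rcases (M.lik_nonneg n Y θ hθ.1).eq_or_lt with h0 | h0
  · rw [← h0]; positivity
  · have hs := h.separation θ hθ h0
    rw [logLik, logLik] at hs
    calc M.lik n Y θ = Real.exp (Real.log (M.lik n Y θ)) := (Real.exp_log h0).symm
      _ ≤ Real.exp (Real.log (M.lik n Y θstar) + -(n * b)) := Real.exp_le_exp.2 (by linarith)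
      _ = M.lik n Y θstar * Real.exp (-(n * b)) := by rw [Real.exp_add, Real.exp_log hlik]
      _ ≤ _ := by gcongr

theorem integrableOn_unnormPost (h : M.RegularDataset n Y θstar θhat δ B ηlo ηhi b c₁ m)
    (hδ : 0 < δ) (hc₁ : 0 < c₁) : IntegrableOn (M.unnormPost n Y) M.space := by
  have hmeas := M.aestronglyMeasurable_unnormPost n Y
  have hball : IntegrableOn (M.unnormPost n Y) (Metric.ball θstar δ) := by
    refine (integrableOn_const (C := M.unnormPost n Y θhat) measure_ball_lt_top.ne).mono'
      (hmeas.mono_measure (Measure.restrict_mono h.ball_subset le_rfl)) ?_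
    refine (ae_restrict_iff' measurableSet_ball).2 (Eventually.of_forall fun θ hθ => ?_)
    rw [Real.norm_of_nonneg (h.unnormPost_pos θ hθ).le]
    exact h.isPosteriorMode.2 (h.ball_subset hθ)
  have hoff : IntegrableOn (M.unnormPost n Y) (M.space \ Metric.ball θstar δ) := by
    refine ((M.integrableOn_prior.mono_set Set.sdiff_subset).mul_const
      (M.unnormPost n Y θhat / c₁ * Real.exp (-(n * b)))).mono'
      (hmeas.mono_measure (Measure.restrict_mono Set.sdiff_subset le_rfl)) ?_
    refine (ae_restrict_iff' (M.measurableSet_space.diff measurableSet_ball)).2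
      (Eventually.of_forall fun θ hθ => ?_)
    rw [Real.norm_of_nonneg (M.unnormPost_nonneg n Y hθ.1)]
    exact h.unnormPost_le_off_ball hδ hc₁ hθ
  have := hball.union hoff
  rwa [Set.union_sdiff_cancel h.ball_subset] at this

theorem unnormPost_eq_exp (h : M.RegularDataset n Y θstar θhat δ B ηlo ηhi b c₁ m)
    {θ : Param p} (hθ : θ ∈ Metric.ball θstar δ) (hδ : 0 < δ) :
    M.unnormPost n Y θ =
      M.unnormPost n Y θhat * Real.exp (M.logPost n Y θ - M.logPost n Y θhat) := by
  have h1 := h.unnormPost_pos θ hθ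
  have h2 := h.unnormPost_pos θhat (h.locallyRegular.mem_ball hδ)
  rw [logPost, logPost, Real.exp_sub, Real.exp_log h1, Real.exp_log h2]
  field_simp

theorem setIntegral_ball (h : M.RegularDataset n Y θstar θhat δ B ηlo ηhi b c₁ m)
    (hδ : 0 < δ) (hm : 4 ≤ m) (hn : 0 < n) (hη : 0 < ηlo) :
    ∫ θ in Metric.ball θstar δ, M.unnormPost n Y θ =
      (scaleMatrix (M.logPost n Y) θhat).det * (M.unnormPost n Y θhat *
        ∫ z, rescaled (M.logPost n Y) θstar θhat δ z) := by
  rw [setIntegral_ball_eq (θhat := θhat) (h.locallyRegular.scale_spec hδ hm hn hη).1]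
  congr 1
  rw [← integral_const_mul]
  have hD : MeasurableSet (adaptedDomain (M.logPost n Y) θstar θhat δ) :=
    isOpen_adaptedDomain.measurableSet
  change ∫ z in adaptedDomain (M.logPost n Y) θstar θhat δ, _ = _
  rw [← integral_indicator hD]
  congr 1
  funext z
  by_cases hz : z ∈ adaptedDomain (M.logPost n Y) θstar θhat δ
  · rw [rescaled, Set.indicator_of_mem hz, Set.indicator_of_mem hz]
    exact h.unnormPost_eq_exp hz hδ
  · rw [rescaled, Set.indicator_of_notMem hz, Set.indicator_of_notMem hz, mul_zero]

theorem setIntegral_off_ball (h : M.RegularDataset n Y θstar θhat δ B ηlo ηhi b c₁ m)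
    (hδ : 0 < δ) (hc₁ : 0 < c₁) :
    0 ≤ ∫ θ in M.space \ Metric.ball θstar δ, M.unnormPost n Y θ ∧
      ∫ θ in M.space \ Metric.ball θstar δ, M.unnormPost n Y θ ≤
        M.unnormPost n Y θhat / c₁ * Real.exp (-(n * b)) := by
  have hmeas := M.measurableSet_space.diff (measurableSet_ball (x := θstar) (ε := δ))
  have hu := M.unnormPost_nonneg n Y h.isPosteriorMode.1
  refine ⟨setIntegral_nonneg hmeas fun θ hθ => M.unnormPost_nonneg n Y hθ.1, ?_⟩
  calc ∫ θ in M.space \ Metric.ball θstar δ, M.unnormPost n Y θ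
      ≤ ∫ θ in M.space \ Metric.ball θstar δ,
          M.prior θ * (M.unnormPost n Y θhat / c₁ * Real.exp (-(n * b))) :=
        setIntegral_mono_on ((h.integrableOn_unnormPost hδ hc₁).mono_set Set.sdiff_subset)
          ((M.integrableOn_prior.mono_set Set.sdiff_subset).mul_const _) hmeas
          fun θ hθ => h.unnormPost_le_off_ball hδ hc₁ hθ
    _ = (∫ θ in M.space \ Metric.ball θstar δ, M.prior θ) *
          (M.unnormPost n Y θhat / c₁ * Real.exp (-(n * b))) := integral_mul_const _ _
    _ ≤ 1 * (M.unnormPost n Y θhat / c₁ * Real.exp (-(n * b))) := by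
        gcongr
        rw [← M.integral_prior]
        refine setIntegral_mono_set M.integrableOn_prior ?_ Set.sdiff_subset.eventuallyLE
        exact (ae_restrict_iff' M.measurableSet_space).2
          (Eventually.of_forall fun θ hθ => M.prior_nonneg θ hθ)
    _ = _ := one_mul _

/-- The prefactor is the one in `setIntegral_ball`, so it cancels in the relative error. The nodes
must lie in the adapted domain because `rescaled` is cut off outside it. -/
theorem adaptedConst_eq (h : M.RegularDataset n Y θstar θhat δ B ηlo ηhi b c₁ m) (hδ : 0 < δ)
    {R : QuadRule p} (hR : ∀ z ∈ R.points, z ∈ adaptedDomain (M.logPost n Y) θstar θhat δ) :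
    M.adaptedConst R n Y θhat =
      (scaleMatrix (M.logPost n Y) θhat).det * (M.unnormPost n Y θhat *
        ∑ z ∈ R.points, rescaled (M.logPost n Y) θstar θhat δ z * R.weight z) := by
  change (scaleMatrix (M.logPost n Y) θhat).det * ∑ z ∈ R.points, M.unnormPost n Y
    (matrixMap (scaleMatrix (M.logPost n Y) θhat) z + θhat) * R.weight z = _
  congr 1
  rw [Finset.mul_sum]
  refine Finset.sum_congr rfl fun z hz => ?_
  rw [rescaled, Set.indicator_of_mem (hR z hz), h.unnormPost_eq_exp (hR z hz) hδ, mul_assoc]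

end RegularDataset

/-- On regular datasets the adapted quadrature approximates the normalizing constant with relative
error `O(n^{-⌊(k+2)/3⌋})`. -/
theorem exists_abs_adaptedConst_sub_le {k : ℕ} {R : QuadRule p} (hsymm : R.IsSymmetric)
    (hexact : R.IsExact k) (hk : 1 ≤ k) {δ B ηlo ηhi b c₁ : ℝ} {m : ℕ} (hδ : 0 < δ) (hm : 4 ≤ m)
    (hkm : k ≤ m / 2) (hη : 0 < ηlo) (hηη : ηlo ≤ ηhi) (hB : 0 ≤ B) (hb : 0 < b) (hc₁ : 0 < c₁) :
    ∃ C : ℝ, 0 < C ∧ ∃ n₀ : ℕ, 0 < n₀ ∧ ∀ n, n₀ ≤ n → ∀ (Y : Dataset d n) (θstar θhat : Param p),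
      M.RegularDataset n Y θstar θhat δ B ηlo ηhi b c₁ m →
      0 < M.normConst n Y ∧
      |M.adaptedConst R n Y θhat - M.normConst n Y| ≤
        C / (n : ℝ) ^ ((k + 2) / 3) * M.normConst n Y := by
  set s := (k + 2) / 3 with hs
  have hη' : 0 < ηhi := hη.trans_le hηη
  obtain ⟨C, c, hC, hc, n₀, hn₀, hcore⟩ :=
    exists_rescaled_quadrature_bound hsymm hexact hk hδ hm hkm hη hηη hB
  set E : ℝ := (p + s).factorial * (1 + ηhi) ^ p / b ^ (p + s) with hE
  have hE0 : 0 < E := by positivity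
  -- `C` comes from the quadrature, `E / c₁` from the mass off the ball; dividing by the lower bound
  -- `c` makes the error relative.
  refine ⟨(C + E / c₁) / c, by positivity, n₀, hn₀, fun n hn Y θstar θhat h => ?_⟩
  have hnpos : 0 < n := by omega
  have hn' : (0 : ℝ) < n := by exact_mod_cast hnpos
  obtain ⟨hpts, hlow, herr⟩ := hcore (M.logPost n Y) θstar θhat n hn h.locallyRegular
  obtain ⟨hdet, hdet2, -⟩ := h.locallyRegular.scale_spec hδ hm hnpos hη
  have hball := h.setIntegral_ball hδ hm hnpos hη
  obtain ⟨hoff0, hoff⟩ := h.setIntegral_off_ball hδ hc₁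
  have hA := h.adaptedConst_eq hδ hpts
  have hu := h.unnormPost_pos θhat (h.locallyRegular.mem_ball hδ)
  have hN : M.normConst n Y = (∫ θ in Metric.ball θstar δ, M.unnormPost n Y θ) +
      ∫ θ in M.space \ Metric.ball θstar δ, M.unnormPost n Y θ := by
    have hint := h.integrableOn_unnormPost hδ hc₁
    rw [normConst, ← setIntegral_union Set.disjoint_sdiff_right
      (M.measurableSet_space.diff measurableSet_ball) (hint.mono_set h.ball_subset)
      (hint.mono_set Set.sdiff_subset), Set.union_sdiff_cancel h.ball_subset]
  set Δ := (scaleMatrix (M.logPost n Y) θhat).det with hΔ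
  set I := ∫ z, rescaled (M.logPost n Y) θstar θhat δ z with hI
  set Q := ∑ z ∈ R.points, rescaled (M.logPost n Y) θstar θhat δ z * R.weight z with hQ
  set u := M.unnormPost n Y θhat with hudef
  set τ := ∫ θ in M.space \ Metric.ball θstar δ, M.unnormPost n Y θ with hτ
  rw [hball] at hN
  -- The sharp exponent is `p / 2`; the cruder `p` avoids half-integer powers and is harmless
  -- against an exponential.
  have hdetinv : 1 ≤ Δ * (1 + n * ηhi) ^ p := by
    have h1 : (n * ηhi) ^ p ≤ ((1 + n * ηhi) ^ p) ^ 2 := by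
      rw [← pow_mul, mul_comm p 2, pow_mul]
      gcongr
      nlinarith [mul_pos hn' hη']
    have h2 : 1 ≤ (Δ * (1 + n * ηhi) ^ p) ^ 2 := by
      rw [mul_pow]
      exact hdet2.trans (by gcongr)
    by_contra hlt
    push Not at hlt
    have h0 : 0 ≤ Δ * (1 + n * ηhi) ^ p := by positivity
    nlinarith
  have hexp : Real.exp (-(n * b)) ≤ Δ * (E / (n : ℝ) ^ s) := by
    have h1 := exp_neg_mul_mul_pow_le hb hη' p s hnpos
    calc Real.exp (-(n * b)) ≤ Real.exp (-(n * b)) * (Δ * (1 + n * ηhi) ^ p) :=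
          le_mul_of_one_le_right (Real.exp_pos _).le hdetinv
      _ = Δ * (Real.exp (-(n * b)) * (1 + n * ηhi) ^ p) := by ring
      _ ≤ _ := by gcongr
  have hNlow : Δ * u * c ≤ M.normConst n Y := by
    rw [hN]
    have : Δ * u * c ≤ Δ * u * I := by gcongr
    linarith
  refine ⟨lt_of_lt_of_le (by positivity) hNlow, ?_⟩
  have hτle : τ ≤ Δ * u * (E / c₁ / (n : ℝ) ^ s) := by
    refine hoff.trans ?_
    calc u / c₁ * Real.exp (-(n * b)) ≤ u / c₁ * (Δ * (E / (n : ℝ) ^ s)) := by gcongr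
      _ = _ := by ring
  calc |M.adaptedConst R n Y θhat - M.normConst n Y|
      = |Δ * u * (Q - I) - τ| := by rw [hA, hN]; congr 1; ring
    _ ≤ |Δ * u * (Q - I)| + |τ| := abs_sub _ _
    _ ≤ Δ * u * (C / (n : ℝ) ^ s) + Δ * u * (E / c₁ / (n : ℝ) ^ s) := by
        rw [abs_mul, abs_of_pos (by positivity : 0 < Δ * u), abs_of_nonneg hoff0]
        gcongr
    _ = (C + E / c₁) / c / (n : ℝ) ^ s * (Δ * u * c) := by field_simp
    _ ≤ _ := by gcongr

/-- The ratio of the two densities does not depend on `θ`: it is the ratio of the constants. With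
division by zero equal to zero this holds even if the adapted constant vanishes. -/
theorem relError_le {n : ℕ} {Y : Dataset d n} {R : QuadRule p} {θhat : Param p} {x : ℝ}
    (hN : 0 < M.normConst n Y)
    (h : |M.adaptedConst R n Y θhat - M.normConst n Y| ≤ x * M.normConst n Y) :
    M.relError n Y (M.post n Y) (M.adaptedPost R n Y θhat) ≤ ENNReal.ofReal x := by
  refine iSup₂_le fun θ hθ => ENNReal.ofReal_le_ofReal ?_
  have hu : M.unnormPost n Y θ ≠ 0 := hθ.2
  have : M.post n Y θ / M.adaptedPost R n Y θhat θ =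
      M.adaptedConst R n Y θhat / M.normConst n Y := by
    rw [post, adaptedPost, div_div_div_eq, mul_comm (M.unnormPost n Y θ), mul_div_mul_right _ _ hu]
  rw [this, div_sub_one hN.ne', abs_div, abs_of_pos hN, div_le_iff₀ hN]
  exact h

/-- The difference of the densities is the unnormalized posterior times `(A - N) / (N A)`. The
condition `x ≤ 1/2` ensures `A ≥ N / 2`, which costs the factor 2. -/
theorem tvDist_le {n : ℕ} {Y : Dataset d n} {R : QuadRule p} {θhat : Param p} {x : ℝ}
    (hint : IntegrableOn (M.unnormPost n Y) M.space) (hN : 0 < M.normConst n Y) (hx : x ≤ 1 / 2)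
    (h : |M.adaptedConst R n Y θhat - M.normConst n Y| ≤ x * M.normConst n Y) :
    M.tvDist (M.post n Y) (M.adaptedPost R n Y θhat) ≤ ENNReal.ofReal (2 * x) := by
  refine iSup₂_le fun K hK => ENNReal.ofReal_le_ofReal ?_
  set N := M.normConst n Y with hNdef
  set A := M.adaptedConst R n Y θhat with hAdef
  have hA : N / 2 ≤ A := by
    have := (abs_le.1 h).1
    nlinarith
  have hA0 : 0 < A := by linarith
  have hpt : ∀ θ, M.post n Y θ - M.adaptedPost R n Y θhat θ =
      M.unnormPost n Y θ * ((A - N) / (N * A)) := by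
    intro θ
    rw [post, adaptedPost, ← hNdef, ← hAdef]
    field_simp
  have hKint : |∫ θ in K ∩ M.space, M.unnormPost n Y θ| ≤ N := by
    have hmeas : MeasurableSet (K ∩ M.space) := MeasurableSet.inter hK M.measurableSet_space
    rw [abs_of_nonneg (setIntegral_nonneg hmeas fun θ hθ => M.unnormPost_nonneg n Y hθ.2)]
    refine setIntegral_mono_set hint ?_ Set.inter_subset_right.eventuallyLE
    exact (ae_restrict_iff' M.measurableSet_space).2
      (Eventually.of_forall fun θ hθ => M.unnormPost_nonneg n Y hθ)
  simp_rw [hpt]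
  rw [integral_mul_const, abs_mul, abs_div, abs_of_pos (mul_pos hN hA0)]
  have hx0 : 0 ≤ x := by
    by_contra hneg
    nlinarith [abs_nonneg (A - N)]
  calc |∫ θ in K ∩ M.space, M.unnormPost n Y θ| * (|A - N| / (N * A))
      ≤ N * (x * N / (N * (N / 2))) := by gcongr
    _ = 2 * x := by field_simp

end BayesModel

/-! ### Events of probability tending to one -/

theorem WithProbTendingToOne.mono {d : ℕ} {P : (n : ℕ) → Measure (Dataset d n)}
    {E F : (n : ℕ) → Dataset d n → Prop} (hE : WithProbTendingToOne P E)
    (h : ∀ᶠ n in atTop, ∀ Y, E n Y → F n Y) : WithProbTendingToOne P F := by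
  refine tendsto_of_tendsto_of_tendsto_of_le_of_le' tendsto_const_nhds hE
    (Eventually.of_forall fun n => zero_le) ?_
  filter_upwards [h] with n hn
  exact measure_mono fun Y hY hE => hY (hn Y hE)

theorem WithProbTendingToOne.and {d : ℕ} {P : (n : ℕ) → Measure (Dataset d n)}
    {E F : (n : ℕ) → Dataset d n → Prop} (hE : WithProbTendingToOne P E)
    (hF : WithProbTendingToOne P F) : WithProbTendingToOne P fun n Y => E n Y ∧ F n Y := by
  have hsum : Tendsto (fun n => P n {Y | ¬ E n Y} + P n {Y | ¬ F n Y}) atTop (𝓝 0) := by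
    simpa using Tendsto.add hE hF
  refine tendsto_of_tendsto_of_tendsto_of_le_of_le tendsto_const_nhds hsum
    (fun n => zero_le) fun n => ?_
  refine (measure_mono fun Y hY => ?_).trans (measure_union_le _ _)
  exact not_and_or.1 hY

theorem RegularAt.norm_sub_le {p d : ℕ} {M : BayesModel p d}
    {P : (n : ℕ) → Measure (Dataset d n)} {θhat : (n : ℕ) → Dataset d n → Param p} {m : ℕ}
    {θstar : Param p} {δ : ℝ} (h : RegularAt M P θhat m θstar δ) (hδ : 0 < δ) :
    WithProbTendingToOne P fun n Y => ‖θhat n Y - θstar‖ ≤ δ / 2 := by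
  -- Choosing `G n = √n` cancels the rate and leaves plain consistency.
  have hG : Tendsto (fun n : ℕ => √(n : ℝ)) atTop atTop :=
    Real.tendsto_sqrt_atTop.comp tendsto_natCast_atTop_atTop
  refine (h.consistency (δ / 2) (by positivity) _ hG).congr' ?_
  filter_upwards [eventually_gt_atTop 0] with n hn
  have : √(n : ℝ) ≠ 0 := by positivity
  simp [div_self this]

/-- Under the regularity assumptions, datasets are regular with probability tending to one. -/
theorem RegularAt.regularDataset {p d : ℕ} {M : BayesModel p d}
    {P : (n : ℕ) → Measure (Dataset d n)} {θhat : (n : ℕ) → Dataset d n → Param p} {m : ℕ}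
    {θstar : Param p} {δ : ℝ} (h : RegularAt M P θhat m θstar δ) (hδ : 0 < δ)
    (hmode : WithProbTendingToOne P fun n Y => M.IsPosteriorMode n Y (θhat n Y)) :
    ∃ B ηlo ηhi b c₁ : ℝ, 0 < B ∧ 0 < ηlo ∧ ηlo ≤ ηhi ∧ 0 < b ∧ 0 < c₁ ∧
      WithProbTendingToOne P fun n Y =>
        M.RegularDataset n Y θstar (θhat n Y) δ B ηlo ηhi b c₁ m := by
  obtain ⟨B, hB, hder⟩ := h.derivatives
  obtain ⟨ηlo, ηhi, hη, hηη, hhess⟩ := h.hessian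
  obtain ⟨b, hb, hsep⟩ := h.separation
  obtain ⟨c₁, c₂, hc₁, -, hprior⟩ := h.prior_bounds
  refine ⟨B, ηlo, ηhi, b, c₁, hB, hη, hηη, hb, hc₁, ?_⟩
  refine ((((hmode.and hder).and hhess).and hsep).and (h.norm_sub_le hδ)).mono
    (Eventually.of_forall fun n Y => ?_)
  rintro ⟨⟨⟨⟨hmd, hpos, htd, hpart⟩, hspec⟩, hs⟩, hnear⟩
  refine ⟨⟨htd, fun j hj i θ hθ => (hpart j hj i θ hθ).le, hspec, hnear, fun θ hθ => ?_⟩, hpos,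
    h.ball_subset, hs, hmd, (hprior θstar (Metric.mem_ball_self hδ)).1⟩
  exact Real.log_le_log (hpos θ hθ) (hmd.2 (h.ball_subset hθ))

end AdaptiveQuadrature

end

theorem corollary1 {p d : ℕ} (M : AdaptiveQuadrature.BayesModel p d)
    (P : (n : ℕ) → Measure (AdaptiveQuadrature.Dataset d n)) [∀ n, IsProbabilityMeasure (P n)]
    (θhat : (n : ℕ) → AdaptiveQuadrature.Dataset d n → AdaptiveQuadrature.Param p)
    (hmode : AdaptiveQuadrature.WithProbTendingToOne P fun n Y =>
      M.IsPosteriorMode n Y (θhat n Y))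
    (m : ℕ) (hm : 4 ≤ m)
    (hdiff : ∀ n, ∀ᵐ Y ∂(P n),
      AdaptiveQuadrature.TimesDifferentiableOn m (M.lik n Y) (interior M.space))
    (hreg : AdaptiveQuadrature.Regular M P θhat m)
    (k : ℕ) (hk : 1 ≤ k) (hkm : k ≤ m / 2)
    (R : AdaptiveQuadrature.QuadRule p) (hsymm : R.IsSymmetric) (hexact : R.IsExact k) :
    ∃ C : ℝ, 0 < C ∧
      (AdaptiveQuadrature.WithProbTendingToOne P fun n Y =>
        M.relError n Y (M.post n Y) (M.adaptedPost R n Y (θhat n Y)) ≤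
          ENNReal.ofReal (C / (n : ℝ) ^ ((k + 2) / 3))) ∧
      (AdaptiveQuadrature.WithProbTendingToOne P fun n Y =>
        M.tvDist (M.post n Y) (M.adaptedPost R n Y (θhat n Y)) ≤
          ENNReal.ofReal (C / (n : ℝ) ^ ((k + 2) / 3))) := by
  obtain ⟨θstar, -, δ, hδ, h⟩ := hreg
  obtain ⟨B, ηlo, ηhi, b, c₁, hB, hη, hηη, hb, hc₁, hdata⟩ := h.regularDataset hδ hmode
  obtain ⟨C, hC, n₀, hn₀, hmain⟩ := M.exists_abs_adaptedConst_sub_le hsymm hexact hk hδ hm hkm hη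
    hηη hB.le hb hc₁
  -- For `n ≥ 2C` the relative error is at most `1/2`, as the exponent of `n` is at least one; this
  -- is the smallness `tvDist_le` needs. Its factor 2 is the one in the final constant.
  obtain ⟨n₁, hn₁⟩ := exists_nat_ge (2 * C)
  refine ⟨2 * C, by positivity, hdata.mono ?_, hdata.mono ?_⟩
  · filter_upwards [eventually_ge_atTop n₀] with n hn Y hY
    obtain ⟨hN, herr⟩ := hmain n hn Y θstar (θhat n Y) hY
    refine (M.relError_le hN herr).trans (ENNReal.ofReal_le_ofReal ?_)
    gcongr
    linarith
  · filter_upwards [eventually_ge_atTop n₀, eventually_ge_atTop n₁] with n hn hn' Y hY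
    obtain ⟨hN, herr⟩ := hmain n hn Y θstar (θhat n Y) hY
    have hn1 : (1 : ℝ) ≤ n := by exact_mod_cast hn₀.trans_le hn
    have hsmall : C / (n : ℝ) ^ ((k + 2) / 3) ≤ 1 / 2 := by
      rw [div_le_iff₀ (by positivity)]
      have h1 : (n : ℝ) ≤ (n : ℝ) ^ ((k + 2) / 3) := le_self_pow₀ hn1 (by omega)
      have h2 : (n₁ : ℝ) ≤ n := by exact_mod_cast hn'
      linarith
    rw [mul_div_assoc]
    exact M.tvDist_le (hY.integrableOn_unnormPost hδ hc₁) hN hsmall herr
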